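/- For every $r>0$ and $R$ there is a constant $C>0$, depending only on $r$ and $R$, with the following property. Let $\rho,\mu>0$, $\nu=\mu/\rho$, let $\tilde\Omega\subset\mathbb R^3$ be a bounded open set, and let $\lambda^*(\cdot,t):\overline{\tilde\Omega}\to\mathbb R^3$, $t\in[t_0,T]$, be one-to-one maps (the motion of the reference), $C^2$ in $(\tilde x,t)$ up to the boundary, with $\tilde F=\partial\lambda^*/\partial\tilde x$, $\tilde J=\det\tilde F>0$ on $\overline{\tilde\Omega}$, and $\tilde v^{\rm ref}=\partial\lambda^*/\partial t$. Let $\tilde v$ ($C^1$ in $(\tilde x,t)$ and $C^2$ in $\tilde x$ up to the boundary) and $\tilde p$ ($C^1$ in $\tilde x$ up to the boundary) satisfy in $\tilde\Omega\times[t_0,T]$ the equations of an incompressible Newtonian fluid in the general reference description without body force, $$\rho\Big(\frac{\partial\tilde v}{\partial t}+\tilde\nabla\tilde v\,\tilde F^{-1}(\tilde v-\tilde v^{\rm ref})\Big)\tilde J=\widetilde{\rm div}\,\tilde P,\qquad \tilde\nabla\tilde v:\tilde F^{-t}=0,$$ $$\tilde P=\Big(-\tilde p I+\mu\big[\tilde\nabla\tilde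 v\tilde F^{-1}+(\tilde\nabla\tilde v\tilde F^{-1})^t\big]\Big)\tilde F^{-t}\tilde J .$$ Suppose that $\partial\tilde\Omega$ is the union of three parts: a free part, on which $\partial\tilde\Omega$ is locally a $C^1$ surface with $\tilde\Omega$ on one side and outward unit normal $\tilde N$, the reference moves in a purely Lagrangian way, $\tilde v=\tilde v^{\rm ref}$, and there is no traction, $\tilde P\tilde N=0$; a fixed impermeable part, again locally $C^1$, on which $\tilde F^{-t}\tilde N\cdot\tilde v=\tilde F^{-t}\tilde N\cdot\tilde v^{\rm ref}=0$ and there is no tangential traction, i.e. $\tilde P\tilde N$ is a multiple of $\tilde F^{-t}\tilde N$; and a no-slip part, on which $\tilde v=0$ (any of the parts may be empty). Write $\Omega(t)=\lambda^*(\tilde\Omega,t)$. Suppose that there are a point $x_0$ and a fixed set $A$ (for instance a rigid body at rest) containing the open ball $B(x_0,r)$, such that for all $t\in[t_0,T]$: the velocity vanishes on $A$, i.e. $\tilde v(\tilde x,t)=0$ whenever $\tilde x\in\overline{\tilde\Omega}$ and $\lambda^*(\tilde x,t)\in A$; every segment from a point of $B(x_0,r)$ to a point of $\Omega(t)$ lies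 in $\Omega(t)\cup A$; and $\Omega(t)$ lies in the closed ball of radius $R$ about $x_0$. Then the kinetic energy $\tilde K(t)=\frac12\rho\,\|\tilde v\tilde J^{1/2}\|^2_{L^2(\tilde\Omega)}$ satisfies $$\tilde K(t)\le\tilde K(t_0)\,e^{-2\nu C(t-t_0)}\qquad\text{for all } t\in[t_0,T].$$ -/

import Mathlib

open Set Matrix

noncomputable section

namespace RefFlow

/-- Three-dimensional Euclidean space. -/
abbrev E3 : Type := EuclideanSpace ℝ (Fin 3)

/-- The Jacobian matrix `(∂ fᵢ / ∂ Xⱼ)` of a vector field with respect to the referential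
coordinates. -/
def jac (f : E3 → E3) (X : E3) : Matrix (Fin 3) (Fin 3) ℝ :=
  Matrix.of fun i j => fderiv ℝ f X (EuclideanSpace.single j 1) i

/-- Row-wise divergence `(∑ⱼ ∂ Aᵢⱼ / ∂ Xⱼ)ᵢ` of a matrix field with respect to the referential
coordinates. -/
def rowDiv (A : E3 → Matrix (Fin 3) (Fin 3) ℝ) (X : E3) : Fin 3 → ℝ :=
  fun i => ∑ j, fderiv ℝ (fun Y => A Y i j) X (EuclideanSpace.single j 1)

/-- The matrix inner product `A : B = ∑ Aᵢⱼ Bᵢⱼ`. -/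
def frob (A B : Matrix (Fin 3) (Fin 3) ℝ) : ℝ := ∑ i, ∑ j, A i j * B i j

/-- The deformation gradient of the reference map `χ t`, which takes the referential configuration
to the spatial configuration at time `t`. -/
def defGrad (χ : ℝ → E3 → E3) (t : ℝ) (X : E3) : Matrix (Fin 3) (Fin 3) ℝ := jac (χ t) X

/-- The velocity of the reference deformation. -/
def refVel (χ : ℝ → E3 → E3) (t : ℝ) (X : E3) : E3 := deriv (fun s => χ s X) t

/-- The velocity gradient `∇̃ṽ F̃⁻¹` (the spatial gradient, in referential coordinates). -/
def spatialGrad (χ v : ℝ → E3 → E3) (t : ℝ) (X : E3) : Matrix (Fin 3) (Fin 3) ℝ :=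
  jac (v t) X * (defGrad χ t X)⁻¹

/-- The Newtonian stress `- p I + 2 μ D`, with `D` the symmetric part of the velocity gradient. -/
def stress (μ : ℝ) (χ v : ℝ → E3 → E3) (p : ℝ → E3 → ℝ) (t : ℝ) (X : E3) :
    Matrix (Fin 3) (Fin 3) ℝ :=
  (-p t X) • (1 : Matrix (Fin 3) (Fin 3) ℝ)
    + μ • (spatialGrad χ v t X + (spatialGrad χ v t X)ᵀ)

/-- The first Piola-Kirchhoff stress `σ̃ F̃⁻ᵀ J̃`. -/
def piola (μ : ℝ) (χ v : ℝ → E3 → E3) (p : ℝ → E3 → ℝ) (t : ℝ) (X : E3) :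
    Matrix (Fin 3) (Fin 3) ℝ :=
  (defGrad χ t X).det • (stress μ χ v p t X * ((defGrad χ t X)⁻¹)ᵀ)

/-- The momentum balance of an incompressible Newtonian fluid in the general reference
description, at time `t` and referential point `X`, with body force `b` per unit mass:
`ρ (∂ṽ/∂t + ∇̃ṽ F̃⁻¹ (ṽ - ṽ_ref)) J̃ = ρ b̃ J̃ + diṽ P̃`. -/
def MomentumBalance (ρ μ : ℝ) (b χ v : ℝ → E3 → E3) (p : ℝ → E3 → ℝ) (t : ℝ) (X : E3) : Prop :=
  ∀ i : Fin 3,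
    ρ * (deriv (fun s => v s X) t i
        + (spatialGrad χ v t X *ᵥ ⇑(v t X - refVel χ t X)) i) * (defGrad χ t X).det
      = ρ * b t X i * (defGrad χ t X).det + rowDiv (piola μ χ v p t) X i

/-- The incompressibility condition `∇̃ṽ : F̃⁻ᵀ = 0`. -/
def Incompressible (χ v : ℝ → E3 → E3) (t : ℝ) (X : E3) : Prop :=
  frob (jac (v t) X) ((defGrad χ t X)⁻¹)ᵀ = 0

/-- `(χ, v, p)` is a classical solution, on the time interval `[t₀, T]` and the referential domain
`Ω`, of the general reference description of an incompressible Newtonian fluid of density `ρ` and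
viscosity `μ` under the body force `b`.  Regularity up to the boundary is expressed by an open
neighbourhood `O` of `[t₀, T] × closure Ω` on which the fields are smooth. -/
structure IsSolution (ρ μ : ℝ) (b : ℝ → E3 → E3) (t₀ T : ℝ) (Ω : Set E3)
    (χ v : ℝ → E3 → E3) (p : ℝ → E3 → ℝ) : Prop where
  regular : ∃ O : Set (ℝ × E3), IsOpen O ∧ Icc t₀ T ×ˢ closure Ω ⊆ O ∧
    ContDiffOn ℝ 2 (Function.uncurry χ) O ∧
    ContDiffOn ℝ 1 (Function.uncurry v) O ∧
    (∀ t ∈ Icc t₀ T, ContDiffOn ℝ 2 (v t) {X | (t, X) ∈ O}) ∧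
    (∀ t ∈ Icc t₀ T, ContDiffOn ℝ 1 (p t) {X | (t, X) ∈ O})
  injective : ∀ t ∈ Icc t₀ T, InjOn (χ t) (closure Ω)
  det_pos : ∀ t ∈ Icc t₀ T, ∀ X ∈ closure Ω, 0 < (defGrad χ t X).det
  momentum : ∀ t ∈ Icc t₀ T, ∀ X ∈ Ω, MomentumBalance ρ μ b χ v p t X
  incompressible : ∀ t ∈ Icc t₀ T, ∀ X ∈ Ω, Incompressible χ v t X

/-- `N` is the outward unit normal of `Ω` at the boundary point `X`, near which the boundary of `Ω`
is a `C¹` surface with `Ω` on one side. -/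
def IsOutwardUnitNormal (Ω : Set E3) (X N : E3) : Prop :=
  ∃ (U : Set E3) (φ : E3 → ℝ), IsOpen U ∧ X ∈ U ∧ ContDiffOn ℝ 1 φ U ∧ φ X = 0 ∧
    gradient φ X ≠ 0 ∧ Ω ∩ U = {Y | Y ∈ U ∧ φ Y < 0} ∧
    N = ‖gradient φ X‖⁻¹ • gradient φ X

/-- The (unnormalized) spatial normal `F̃⁻ᵀ N` that belongs to a referential normal `N`. -/
def spatialNormal (χ : ℝ → E3 → E3) (t : ℝ) (X N : E3) : Fin 3 → ℝ :=
  ((defGrad χ t X)⁻¹)ᵀ *ᵥ ⇑N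

/-- A traction-free free boundary point at which the reference moves in a purely Lagrangian way:
`ṽ = ṽ_ref` and `P̃ N = 0`. -/
def IsLagrangianFree (μ : ℝ) (Ω : Set E3) (χ v : ℝ → E3 → E3) (p : ℝ → E3 → ℝ)
    (t : ℝ) (X : E3) : Prop :=
  v t X = refVel χ t X ∧
    (∃ N, IsOutwardUnitNormal Ω X N) ∧
    ∀ N, IsOutwardUnitNormal Ω X N → piola μ χ v p t X *ᵥ ⇑N = 0

/-- A point of a fixed impermeable wall without tangential traction: neither the fluid nor the
reference crosses the wall, and the traction `P̃ N` is a multiple of the spatial normal. -/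
def IsFixedImpermeable (μ : ℝ) (Ω : Set E3) (χ v : ℝ → E3 → E3) (p : ℝ → E3 → ℝ)
    (t : ℝ) (X : E3) : Prop :=
  (∃ N, IsOutwardUnitNormal Ω X N) ∧
    ∀ N, IsOutwardUnitNormal Ω X N →
      spatialNormal χ t X N ⬝ᵥ ⇑(v t X) = 0 ∧
      spatialNormal χ t X N ⬝ᵥ ⇑(refVel χ t X) = 0 ∧
      ∃ a : ℝ, piola μ χ v p t X *ᵥ ⇑N = a • spatialNormal χ t X N

/-- The kinetic energy `½ ρ ‖ṽ J̃^{1/2}‖²` in `L²(Ω)`. -/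
def kineticEnergy (ρ : ℝ) (Ω : Set E3) (χ v : ℝ → E3 → E3) (t : ℝ) : ℝ :=
  1 / 2 * ρ * ∫ X in Ω, ‖Real.sqrt (defGrad χ t X).det • v t X‖ ^ 2

end RefFlow

end

noncomputable section

namespace RefFlow

open MeasureTheory Filter Topology
open scoped Manifold ContDiff ENNReal

/-! Write `J` for the determinant of the deformation gradient, `L` for the spatial velocity gradient
and `ν = μ / ρ`. Two facts give the decay.

Energy balance: the derivative of `∫ J |v|²` is `-2 ν ∫ J (L + Lᵀ) : L`. Pointwise, momentum tested
with `v`, incompressibility, the Piola identity and Jacobi's formula for `∂J/∂t` make `∂(J |v|²)/∂t`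
equal to `2/ρ` times the divergence of `energyFlux` minus `2 ν` times `dissipation`
(`hasDerivAt_energyDensity`). The flux is tangential on the free part and on the wall, and zero on
the no-slip part, so its divergence integrates to zero. Nothing is assumed about the shape of the
boundary on the no-slip part, so a divergence theorem is needed that asks for a `C¹` surface only
where the field does not vanish (`setIntegral_divergence_eq_zero`). It is proved with cutoffs and
without surface measure.

Korn-Poincaré inequality: with `C` built from `r` and `R` alone, `C ∫ J |v|² ≤ ∫ J (L + Lᵀ) : L`
(`korn_referential`). For the spatial velocity `u`, extended by zero, and `y` in the ball about
`x₀`, where `u` vanishes, the function `⟨u(y + s(x - y)), x - y⟩` of `s` has derivative `⟨∇u (x -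
y), x - y⟩`, which involves only the symmetric part of `∇u`. Integrating along the segment bounds
`⟨u(x), x - y⟩` by the strain. The vectors `x - y`, with `y` in a ball, are spread enough to recover
`|u(x)|²` by integration in `y`; integration in `x` and a change of variables for each `s` then give
the inequality (`korn_poincare`).

Together, `E = ∫ J |v|²` satisfies `E' ≤ -2 ν C E`, and Grönwall's argument finishes
(`le_mul_exp_of_deriv_le`). -/

/-- The divergence of a vector field. -/
def divergence (H : E3 → E3) (X : E3) : ℝ :=
  ∑ j, fderiv ℝ H X (EuclideanSpace.single j 1) j

/-! ### Divergence of compactly supported fields -/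

theorem exists_cutoff {K U : Set E3} (hK : IsCompact K) (hU : IsOpen U) (hKU : K ⊆ U) :
    ∃ κ : E3 → ℝ, ContDiff ℝ 2 κ ∧ HasCompactSupport κ ∧ tsupport κ ⊆ U ∧
      (∀ᶠ x in 𝓝ˢ K, κ x = 1) ∧ ∀ x, κ x ∈ Icc (0 : ℝ) 1 := by
  obtain ⟨L, hL, hKL, hLU⟩ := exists_compact_between hK hU hKU
  obtain ⟨f, h1, h0, h⟩ := exists_contMDiffMap_one_nhds_of_subset_interior (n := 2)
    (𝓘(ℝ, E3)) hK.isClosed hKL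
  have hs : tsupport f ⊆ L := by
    refine closure_minimal (fun x hx => ?_) hL.isClosed
    by_contra hxL
    exact hx (h0 x hxL)
  exact ⟨f, f.contMDiff.contDiff, HasCompactSupport.of_support_subset_isCompact hL
    (subset_closure.trans hs), hs.trans hLU, h1, h⟩

theorem sum_coord_smul_single (y : E3) :
    ∑ j, y j • (EuclideanSpace.single j (1 : ℝ) : E3) = y := by
  ext i
  simp [Fin.sum_univ_three]
  fin_cases i <;> simp

theorem sum_clm_single_mul (A : E3 →L[ℝ] ℝ) (y : E3) :
    ∑ j, A (EuclideanSpace.single j 1) * y j = A y := by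
  conv_rhs => rw [← sum_coord_smul_single y]
  simp [mul_comm]

theorem divergence_smul {ψ : E3 → ℝ} {G : E3 → E3} {x : E3} (hψ : DifferentiableAt ℝ ψ x)
    (hG : DifferentiableAt ℝ G x) :
    divergence (fun y => ψ y • G y) x = ψ x * divergence G x + fderiv ℝ ψ x (G x) := by
  unfold divergence
  rw [fderiv_fun_smul hψ hG, ← sum_clm_single_mul (fderiv ℝ ψ x) (G x), Finset.mul_sum,
    ← Finset.sum_add_distrib]
  simp

theorem divergence_congr {G H : E3 → E3} {x : E3} (h : G =ᶠ[𝓝 x] H) :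
    divergence G x = divergence H x := by
  unfold divergence
  rw [h.fderiv_eq]

theorem divergence_zero_of_eventually {G : E3 → E3} {x : E3} (h : ∀ᶠ y in 𝓝 x, G y = 0) :
    divergence G x = 0 := by
  rw [divergence_congr (show G =ᶠ[𝓝 x] fun _ => 0 from h)]
  simp [divergence]

theorem divergence_zero_of_notMem {G : E3 → E3} {x : E3} (h : x ∉ tsupport G) :
    divergence G x = 0 :=
  divergence_zero_of_eventually (notMem_tsupport_iff_eventuallyEq.1 h)

theorem continuous_divergence {G : E3 → E3} (hG : ContDiff ℝ 1 G) :
    Continuous (divergence G) := by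
  unfold divergence
  have := hG.continuous_fderiv (by norm_num)
  fun_prop

theorem hasCompactSupport_divergence {G : E3 → E3} (hc : HasCompactSupport G) :
    HasCompactSupport (divergence G) :=
  HasCompactSupport.intro' hc (isClosed_tsupport _) fun _ hx => divergence_zero_of_notMem hx

theorem integrable_divergence {G : E3 → E3} (hG : ContDiff ℝ 1 G) (hc : HasCompactSupport G) :
    Integrable (divergence G) :=
  (continuous_divergence hG).integrable_of_hasCompactSupport (hasCompactSupport_divergence hc)

/-- Integration by parts against the constant function `1`. -/
theorem integral_fderiv_eq_zero {g : E3 → ℝ} (hg : ContDiff ℝ 1 g) (hc : HasCompactSupport g)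
    (e : E3) : ∫ x, fderiv ℝ g x e = 0 := by
  have hi : Integrable fun x => fderiv ℝ g x e :=
    ((hg.continuous_fderiv (by norm_num)).clm_apply continuous_const).integrable_of_hasCompactSupport
      (hc.fderiv_apply ℝ e)
  have := integral_mul_fderiv_eq_neg_fderiv_mul_of_integrable (μ := (volume : Measure E3))
    (f := fun _ => (1 : ℝ)) (g := g) (v := e) (by simp) (by simpa using hi)
    (by simpa using hg.continuous.integrable_of_hasCompactSupport hc) (by simp)
    (fun x _ => hg.differentiable (by norm_num) x)
  simpa using this

theorem integral_divergence_eq_zero {G : E3 → E3} (hG : ContDiff ℝ 1 G)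
    (hc : HasCompactSupport G) : ∫ x, divergence G x = 0 := by
  have key : ∀ j x, fderiv ℝ G x (EuclideanSpace.single j 1) j
      = fderiv ℝ (fun y => G y j) x (EuclideanSpace.single j 1) := by
    intro j x
    have h := (hG.differentiable (by norm_num) x).hasFDerivAt
    have := ((EuclideanSpace.proj (𝕜 := ℝ) j : E3 →L[ℝ] ℝ).hasFDerivAt.comp x h).fderiv
    have h2 : ((EuclideanSpace.proj (𝕜 := ℝ) j : E3 →L[ℝ] ℝ) ∘ G) = fun y => G y j := rfl
    rw [h2] at this
    rw [this]
    rfl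
  have hG' : ∀ j, ContDiff ℝ 1 (fun y => G y j) := fun j => by fun_prop
  have hc' : ∀ j, HasCompactSupport (fun y => G y j) := fun j =>
    hc.comp_left (g := fun y : E3 => y j) rfl
  unfold divergence
  simp_rw [key]
  rw [integral_finsetSum]
  · simp [integral_fderiv_eq_zero (hG' _) (hc' _)]
  · intro j _
    exact (((hG' j).continuous_fderiv (by norm_num)).clm_apply
      continuous_const).integrable_of_hasCompactSupport ((hc' j).fderiv_apply ℝ _)

/-! ### Divergence theorem near a `C¹` piece of the boundary -/

/-- A smooth nondecreasing step, `0` on `(-∞, 1]` and `1` on `[2, ∞)`. -/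
def step (s : ℝ) : ℝ := Real.smoothTransition (s - 1)

theorem contDiff_step : ContDiff ℝ 1 step :=
  (Real.smoothTransition.contDiff (n := 1)).comp (contDiff_id.sub contDiff_const)

theorem step_of_le {s : ℝ} (h : s ≤ 1) : step s = 0 :=
  Real.smoothTransition.zero_of_nonpos (by linarith)

theorem step_of_ge {s : ℝ} (h : 2 ≤ s) : step s = 1 :=
  Real.smoothTransition.one_of_one_le (by linarith)

theorem step_nonneg (s : ℝ) : 0 ≤ step s := Real.smoothTransition.nonneg _

theorem step_le_one (s : ℝ) : step s ≤ 1 := Real.smoothTransition.le_one _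

theorem step_monotone : Monotone step := fun _ _ h =>
  Real.smoothTransition.monotone (by linarith)

theorem deriv_step_nonneg (s : ℝ) : 0 ≤ deriv step s := step_monotone.deriv_nonneg

theorem deriv_step_of_lt {s : ℝ} (h : s < 1) : deriv step s = 0 := by
  have : step =ᶠ[𝓝 s] fun _ => 0 := by
    filter_upwards [Iio_mem_nhds h] with y hy using step_of_le (le_of_lt hy)
  rw [this.deriv_eq, deriv_const]

theorem deriv_step_of_gt {s : ℝ} (h : 2 < s) : deriv step s = 0 := by
  have : step =ᶠ[𝓝 s] fun _ => 1 := by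
    filter_upwards [Ioi_mem_nhds h] with y hy using step_of_ge (le_of_lt hy)
  rw [this.deriv_eq, deriv_const]

theorem exists_deriv_step_le : ∃ M : ℝ, 0 ≤ M ∧ ∀ s, deriv step s ≤ M := by
  obtain ⟨M, hM⟩ := (isCompact_Icc (a := (1 : ℝ)) (b := 2)).exists_bound_of_continuousOn
    (contDiff_step.continuous_deriv (by norm_num)).continuousOn
  refine ⟨max M 0, le_max_right _ _, fun s => ?_⟩
  by_cases h1 : s < 1
  · rw [deriv_step_of_lt h1]; exact le_max_right _ _
  by_cases h2 : 2 < s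
  · rw [deriv_step_of_gt h2]; exact le_max_right _ _
  · exact ((le_abs_self _).trans (hM s ⟨not_lt.1 h1, not_lt.1 h2⟩)).trans (le_max_left _ _)

theorem fderiv_step_comp {f : E3 → ℝ} {x : E3} (hf : DifferentiableAt ℝ f x) (w : E3) :
    fderiv ℝ (fun y => step (f y)) x w = deriv step (f x) * fderiv ℝ f x w := by
  have h := (contDiff_step.differentiable (by norm_num) (f x)).hasDerivAt.comp_hasFDerivAt x
    hf.hasFDerivAt
  have h2 : fderiv ℝ (fun y => step (f y)) x = deriv step (f x) • fderiv ℝ f x := h.fderiv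
  rw [h2]; rfl

theorem contDiff_cutoff_smul {F : Type*} [NormedAddCommGroup F] [NormedSpace ℝ F] {κ : E3 → ℝ}
    {f : E3 → F} {U : Set E3} (hU : IsOpen U) (hκ : ContDiff ℝ 1 κ) (hs : tsupport κ ⊆ U)
    (hf : ContDiffOn ℝ 1 f U) : ContDiff ℝ 1 (fun x => κ x • f x) := by
  rw [contDiff_iff_contDiffAt]
  intro x
  by_cases hx : x ∈ U
  · exact hκ.contDiffAt.smul (hf.contDiffAt (hU.mem_nhds hx))
  · have h : (fun x => κ x • f x) =ᶠ[𝓝 x] fun _ => 0 := by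
      filter_upwards [notMem_tsupport_iff_eventuallyEq.1 (fun h => hx (hs h))] with y hy
      simp [hy]
    exact (contDiffAt_const (c := (0 : F))).congr_of_eventuallyEq h

theorem exists_pos_le_of_isCompact {K : Set E3} (hK : IsCompact K) {f : E3 → ℝ}
    (hf : ContinuousOn f K) (hpos : ∀ x ∈ K, 0 < f x) : ∃ c > 0, ∀ x ∈ K, c ≤ f x := by
  rcases K.eq_empty_or_nonempty with rfl | hne
  · exact ⟨1, one_pos, by simp⟩
  · obtain ⟨x, hx, hm⟩ := hK.exists_isMinOn hne hf
    exact ⟨f x, hpos x hx, fun y hy => hm hy⟩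

/-- The divergence theorem for a tangential field supported near a `C¹` piece of the boundary. -/
theorem setIntegral_divergence_of_local {Ω U : Set E3} {φ : E3 → ℝ} {e : E3} {G : E3 → E3}
    (hΩ : MeasurableSet Ω) (hU : IsOpen U) (hφ : ContDiffOn ℝ 1 φ U)
    (hΩU : Ω ∩ U = {Y | Y ∈ U ∧ φ Y < 0}) (he : ∀ y ∈ U, 0 < fderiv ℝ φ y e)
    (hG : ContDiff ℝ 1 G) (hc : HasCompactSupport G) (hs : tsupport G ⊆ U)
    (hN : ∀ y ∈ U, y ∈ frontier Ω → fderiv ℝ φ y (G y) = 0) :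
    ∫ x in Ω, divergence G x = 0 := by
  -- Two nested cutoffs: `χ = 1` near the support of `G`, and `κ = 1` near the support of `χ`. Hence
  -- `Φ = κ φ` is `C¹` on the whole space and agrees with `φ` near the support of `χ`.
  obtain ⟨χ, hχ, hχc, hχU, hχ1, hχI⟩ := exists_cutoff hc hU hs
  obtain ⟨κ, hκ, -, hκU, hκ1, -⟩ := exists_cutoff hχc hU hχU
  replace hχ : ContDiff ℝ 1 χ := hχ.of_le (by norm_num)
  replace hκ : ContDiff ℝ 1 κ := hκ.of_le (by norm_num)
  set Φ : E3 → ℝ := fun x => κ x • φ x with hΦdef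
  have hΦ : ContDiff ℝ 1 Φ := contDiff_cutoff_smul hU hκ hκU hφ
  have hΦd : Differentiable ℝ Φ := hΦ.differentiable (by norm_num)
  have hΦφ : ∀ x ∈ tsupport χ, Φ =ᶠ[𝓝 x] φ := by
    intro x hx
    filter_upwards [eventually_nhdsSet_iff_forall.1 hκ1 x hx] with y hy
    simp [hΦdef, hy]
  have hGχ : ∀ x ∈ tsupport G, χ x = 1 := fun x hx =>
    (eventually_nhdsSet_iff_forall.1 hχ1 x hx).self_of_nhds
  have hsub : tsupport G ⊆ tsupport χ := fun x hx =>
    subset_tsupport _ (by simp [hGχ x hx])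
  have hfΦ : Continuous fun x => fderiv ℝ Φ x := hΦ.continuous_fderiv (by norm_num)
  obtain ⟨c, hc0, hcle⟩ := exists_pos_le_of_isCompact (f := fun x => fderiv ℝ Φ x e) hχc
    (by fun_prop) (fun x hx => by rw [(hΦφ x hx).fderiv_eq]; exact he x (hχU hx))
  -- `θ n` is a smooth inner approximation of the indicator of `{Φ < 0}`: it vanishes where `-Φ ≤
  -- 1/n` and is `1` where `-Φ ≥ 2/n`. Its gradient is `-w n ∇Φ`, with `w n` concentrated in the
  -- layer between.
  set θ : ℕ → E3 → ℝ := fun n x => step (-(n * Φ x)) with hθdef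
  have hθ : ∀ n, ContDiff ℝ 1 (θ n) := fun n =>
    contDiff_step.comp ((contDiff_const.mul hΦ).neg)
  set w : ℕ → E3 → ℝ := fun n x => n * deriv step (-(n * Φ x)) with hwdef
  have hw0 : ∀ n x, 0 ≤ w n x := fun n x => mul_nonneg n.cast_nonneg (deriv_step_nonneg _)
  have hwc : ∀ n, Continuous (w n) := fun n => by
    have := contDiff_step.continuous_deriv (by norm_num)
    have h2 := hΦ.continuous
    fun_prop
  have hθ' : ∀ n x v, fderiv ℝ (θ n) x v = -(w n x * fderiv ℝ Φ x v) := by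
    intro n x v
    rw [hθdef, fderiv_step_comp (by fun_prop)]
    rw [fderiv_fun_neg, fderiv_const_mul (hΦd x)]
    simp [hwdef]; ring
  have hθd : ∀ n, Differentiable ℝ (θ n) := fun n => (hθ n).differentiable (by norm_num)
  have hGd : Differentiable ℝ G := hG.differentiable (by norm_num)
  have hχd : Differentiable ℝ χ := hχ.differentiable (by norm_num)
  have hfχ : Continuous fun x => fderiv ℝ χ x := hχ.continuous_fderiv (by norm_num)
  have hint1 : ∀ n, Integrable fun x => θ n x * divergence G x := fun n =>
    ((hθ n).continuous.mul (continuous_divergence hG)).integrable_of_hasCompactSupport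
      (hasCompactSupport_divergence hc).mul_left
  have hint2 : ∀ n, Integrable fun x => w n x * fderiv ℝ Φ x (G x) := fun n => by
    have h1 := hwc n
    have h2 := hG.continuous
    refine Continuous.integrable_of_hasCompactSupport (by fun_prop) ?_
    refine HasCompactSupport.intro hc fun x hx => ?_
    simp [image_eq_zero_of_notMem_tsupport hx]
  have hint3 : ∀ n, Integrable fun x => θ n x * fderiv ℝ χ x e := fun n => by
    have h1 := (hθ n).continuous
    exact Continuous.integrable_of_hasCompactSupport (by fun_prop) (hχc.fderiv_apply ℝ e).mul_left
  have hint4 : ∀ n, Integrable fun x => w n x * fderiv ℝ Φ x e * χ x := fun n => by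
    have h1 := hwc n
    have h2 := hχ.continuous
    exact Continuous.integrable_of_hasCompactSupport (by fun_prop) hχc.mul_left
  -- The divergence of `θ n • G` has integral zero, which turns the bulk integral into one over the
  -- layer.
  have hA : ∀ n, ∫ x, θ n x * divergence G x = ∫ x, w n x * fderiv ℝ Φ x (G x) := by
    intro n
    have h := integral_divergence_eq_zero ((hθ n).smul hG) hc.smul_left
    have h2 : ∀ x, divergence (θ n • G) x
        = θ n x * divergence G x - w n x * fderiv ℝ Φ x (G x) := by
      intro x
      have := divergence_smul (hθd n x) (hGd x)
      rw [hθ'] at this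
      rw [sub_eq_add_neg, ← this]; rfl
    simp_rw [h2] at h
    rw [integral_sub (hint1 n) (hint2 n)] at h
    linarith
  -- The same with `χ e` in place of `G`. Since `e` is transversal to the boundary, this bounds the
  -- mass of `w n` uniformly in `n`, although `w n` itself grows like `n`.
  have hB : ∀ n, ∫ x, w n x * fderiv ℝ Φ x e * χ x = ∫ x, θ n x * fderiv ℝ χ x e := by
    intro n
    have h : ∫ x, fderiv ℝ (θ n * χ) x e = 0 :=
      integral_fderiv_eq_zero ((hθ n).mul hχ) hχc.mul_left e
    have h2 : ∀ x, fderiv ℝ (θ n * χ) x e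
        = θ n x * fderiv ℝ χ x e - w n x * fderiv ℝ Φ x e * χ x := by
      intro x
      rw [fderiv_mul (hθd n x) (hχd x)]
      simp only [_root_.add_apply, _root_.smul_apply, smul_eq_mul, hθ']
      ring
    simp_rw [h2] at h
    rw [integral_sub (hint3 n) (hint4 n)] at h
    linarith
  set B : ℝ := ∫ x, |fderiv ℝ χ x e| with hBdef
  have hB' : ∀ n, ∫ x, w n x * fderiv ℝ Φ x e * χ x ≤ B := by
    intro n
    rw [hB]
    refine integral_mono (hint3 n) ?_ fun x => ?_
    · exact (Continuous.integrable_of_hasCompactSupport (by fun_prop) (hχc.fderiv_apply ℝ e)).abs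
    · refine (le_abs_self _).trans ?_
      rw [abs_mul, abs_of_nonneg (step_nonneg _)]
      exact mul_le_of_le_one_left (abs_nonneg _) (step_le_one _)
  have hB0 : 0 ≤ B := integral_nonneg fun x => abs_nonneg _
  have hΩiff : ∀ x ∈ tsupport χ, (x ∈ Ω ↔ Φ x < 0) := by
    intro x hx
    rw [(hΦφ x hx).self_of_nhds]
    have := Set.ext_iff.1 hΩU x
    simpa [hχU hx] using this
  -- On the compact part of `closure Ω` where the normal component of `G` is at least `δ`, `Φ` stays
  -- below some `-ε`, because that component vanishes on the frontier. Once `2/n < ε` the layer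
  -- misses this part, so the layer integral is at most `δ` times the bounded mass.
  have hsmall : ∀ δ > 0, ∀ᶠ n : ℕ in atTop, |∫ x, θ n x * divergence G x| ≤ δ / c * B := by
    intro δ hδ
    set K : Set E3 := tsupport G ∩ (closure Ω ∩ {x | δ ≤ |fderiv ℝ Φ x (G x)|}) with hK
    have hKc : IsCompact K := by
      refine hc.inter_right (isClosed_closure.inter ?_)
      have h2 := hG.continuous
      exact isClosed_le continuous_const (by fun_prop)
    obtain ⟨ε, hε, hεle⟩ := exists_pos_le_of_isCompact (f := fun x => -Φ x) hKc
      (hΦ.continuous.neg.continuousOn) (by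
        rintro x ⟨hxG, hxc, hxδ⟩
        by_contra hneg
        have hx0 : ¬ Φ x < 0 := fun h => hneg (by linarith)
        have hxΩ : x ∉ Ω := fun h => hx0 ((hΩiff x (hsub hxG)).1 h)
        have hxf : x ∈ frontier Ω := ⟨hxc, fun h => hxΩ (interior_subset h)⟩
        have := hN x (hs hxG) hxf
        rw [← (hΦφ x (hsub hxG)).fderiv_eq] at this
        simp only [mem_ofPred_eq, this, abs_zero] at hxδ
        linarith)
    obtain ⟨N, hNN⟩ := exists_nat_gt (2 / ε)
    filter_upwards [eventually_ge_atTop N] with n hn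
    have hpt : ∀ x, |w n x * fderiv ℝ Φ x (G x)| ≤ δ / c * (w n x * fderiv ℝ Φ x e * χ x) := by
      intro x
      by_cases hxG : x ∈ tsupport G
      · rw [abs_mul, abs_of_nonneg (hw0 n x), hGχ x hxG]
        by_cases hwx : w n x = 0
        · simp [hwx]
        have hd : deriv step (-(n * Φ x)) ≠ 0 := fun h => hwx (by simp [hwdef, h])
        have h1 : 1 ≤ -(n * Φ x) := by
          by_contra h; exact hd (deriv_step_of_lt (not_le.1 h))
        have h2 : -(n * Φ x) ≤ 2 := by
          by_contra h; exact hd (deriv_step_of_gt (not_le.1 h))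
        have hn0 : (0 : ℝ) ≤ n := n.cast_nonneg
        have hΦ0 : Φ x < 0 := by
          by_contra h
          nlinarith [mul_nonneg hn0 (not_lt.1 h)]
        have hxΩ := (hΩiff x (hsub hxG)).2 hΦ0
        have hlt : |fderiv ℝ Φ x (G x)| < δ := by
          by_contra h
          have h3 := hεle x ⟨hxG, subset_closure hxΩ, not_lt.1 h⟩
          have h4 : 2 < n * ε := by
            rw [div_lt_iff₀ hε] at hNN
            have : (N : ℝ) ≤ n := by exact_mod_cast hn
            nlinarith
          nlinarith
        have hce := hcle x (hsub hxG)
        have : δ ≤ δ / c * fderiv ℝ Φ x e := by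
          rw [div_mul_eq_mul_div, le_div_iff₀ hc0]
          exact mul_le_mul_of_nonneg_left hce hδ.le
        calc w n x * |fderiv ℝ Φ x (G x)| ≤ w n x * (δ / c * fderiv ℝ Φ x e) :=
              mul_le_mul_of_nonneg_left (hlt.le.trans this) (hw0 n x)
          _ = _ := by ring
      · have hz : G x = 0 := image_eq_zero_of_notMem_tsupport hxG
        rw [hz, map_zero, mul_zero, abs_zero]
        by_cases hxχ : x ∈ tsupport χ
        · exact mul_nonneg (by positivity) (mul_nonneg (mul_nonneg (hw0 n x)
            (hc0.le.trans (hcle x hxχ))) (hχI x).1)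
        · simp [image_eq_zero_of_notMem_tsupport hxχ]
    rw [hA]
    calc |∫ x, w n x * fderiv ℝ Φ x (G x)| ≤ ∫ x, |w n x * fderiv ℝ Φ x (G x)| :=
          abs_integral_le_integral_abs
      _ ≤ ∫ x, δ / c * (w n x * fderiv ℝ Φ x e * χ x) :=
          integral_mono (hint2 n).abs ((hint4 n).const_mul _) hpt
      _ = δ / c * ∫ x, (w n x * fderiv ℝ Φ x e * χ x) := integral_const_mul _ _
      _ ≤ _ := mul_le_mul_of_nonneg_left (hB' n) (by positivity)
  have hlim : Tendsto (fun n : ℕ => ∫ x, θ n x * divergence G x) atTop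
      (𝓝 (∫ x, Ω.indicator (divergence G) x)) := by
    refine tendsto_integral_of_dominated_convergence (fun x => |divergence G x|)
      (fun n => (hint1 n).aestronglyMeasurable) (integrable_divergence hG hc).abs ?_ ?_
    · intro n
      refine Eventually.of_forall fun x => ?_
      rw [Real.norm_eq_abs, abs_mul, abs_of_nonneg (step_nonneg _)]
      exact mul_le_of_le_one_left (abs_nonneg _) (step_le_one _)
    · refine Eventually.of_forall fun x => ?_
      by_cases hxG : x ∈ tsupport G
      · by_cases hxΩ : x ∈ Ω
        · rw [indicator_of_mem hxΩ]
          have h0 := (hΩiff x (hsub hxG)).1 hxΩ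
          refine tendsto_const_nhds.congr' ?_
          obtain ⟨N, hNN⟩ := exists_nat_gt (2 / (-Φ x))
          filter_upwards [eventually_ge_atTop N] with n hn
          have h4 : 2 ≤ -(n * Φ x) := by
            rw [div_lt_iff₀ (by linarith)] at hNN
            have : (N : ℝ) ≤ n := by exact_mod_cast hn
            nlinarith
          simp [hθdef, step_of_ge h4]
        · rw [indicator_of_notMem hxΩ]
          have h0 : 0 ≤ Φ x := not_lt.1 fun h => hxΩ ((hΩiff x (hsub hxG)).2 h)
          refine tendsto_const_nhds.congr fun n => ?_
          have h4 : -(n * Φ x) ≤ 1 := by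
            have := mul_nonneg (n.cast_nonneg (α := ℝ)) h0
            linarith
          simp [hθdef, step_of_le h4]
      · have hz := divergence_zero_of_notMem hxG
        have : Ω.indicator (divergence G) x = 0 := by
          by_cases h : x ∈ Ω <;> simp [h, hz]
        simp [hz, this]
  rw [← integral_indicator hΩ]
  have habs : ∀ δ > 0, |∫ x, Ω.indicator (divergence G) x| ≤ δ / c * B := fun δ hδ =>
    le_of_tendsto hlim.abs (hsmall δ hδ)
  rw [← abs_nonpos_iff]
  refine le_of_forall_pos_le_add fun η hη => ?_
  -- This `δ` makes the bound equal to `η B / (B + 1) ≤ η`; the `+ 1` covers `B = 0`.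
  have := habs (η * c / (B + 1)) (by positivity)
  refine this.trans ?_
  have : η * c / (B + 1) / c * B = η * (B / (B + 1)) := by field_simp
  rw [this, zero_add]
  exact mul_le_of_le_one_right hη.le ((div_le_one (by linarith)).2 (by linarith))

/-! ### From local to global, and removal of the zeros of the field on the boundary -/

/-- Near `X` the boundary of `Ω` is a `C¹` hypersurface to which `G` is tangential. -/
def IsTangentialAt (Ω : Set E3) (G : E3 → E3) (X : E3) : Prop :=
  ∃ (U : Set E3) (φ : E3 → ℝ), IsOpen U ∧ X ∈ U ∧ ContDiffOn ℝ 1 φ U ∧ fderiv ℝ φ X ≠ 0 ∧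
    Ω ∩ U = {Y | Y ∈ U ∧ φ Y < 0} ∧ ∀ Y ∈ U, Y ∈ frontier Ω → fderiv ℝ φ Y (G Y) = 0

theorem IsTangentialAt.smul {Ω : Set E3} {G : E3 → E3} {X : E3} (h : IsTangentialAt Ω G X)
    (ψ : E3 → ℝ) : IsTangentialAt Ω (fun Y => ψ Y • G Y) X := by
  obtain ⟨U, φ, hU, hX, hφ, hd, hΩ, hN⟩ := h
  exact ⟨U, φ, hU, hX, hφ, hd, hΩ, fun Y hY hY' => by simp [hN Y hY hY']⟩

theorem tsupport_fun_smul_subset (ψ : E3 → ℝ) (G : E3 → E3) :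
    tsupport (fun y => ψ y • G y) ⊆ tsupport ψ :=
  tsupport_smul_subset_left ψ G

theorem hasCompactSupport_fun_smul {G : E3 → E3} (hc : HasCompactSupport G) (ψ : E3 → ℝ) :
    HasCompactSupport (fun y => ψ y • G y) :=
  HasCompactSupport.smul_left (f := ψ) hc

theorem contDiff_fun_smul {ψ : E3 → ℝ} {G : E3 → E3} (hψ : ContDiff ℝ 1 ψ)
    (hG : ContDiff ℝ 1 G) : ContDiff ℝ 1 (fun y => ψ y • G y) :=
  hψ.smul hG

/-- By a partition of unity: each piece lies inside `Ω`, or where `G` vanishes, or near a `C¹` piece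
of the boundary. -/
theorem setIntegral_divergence_of_eventually {Ω : Set E3} (hΩ : IsOpen Ω)
    (hb : Bornology.IsBounded Ω) {G : E3 → E3} (hG : ContDiff ℝ 1 G) (hc : HasCompactSupport G)
    (hbd : ∀ X ∈ frontier Ω, (∀ᶠ y in 𝓝 X, G y = 0) ∨ IsTangentialAt Ω G X) :
    ∫ x in Ω, divergence G x = 0 := by
  have hloc : ∀ X ∈ closure Ω, ∃ W : Set E3, IsOpen W ∧ X ∈ W ∧ ∀ ψ : E3 → ℝ, ContDiff ℝ 1 ψ →
      tsupport ψ ⊆ W → ∫ x in Ω, divergence (fun y => ψ y • G y) x = 0 := by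
    intro X hX
    by_cases hXΩ : X ∈ Ω
    · refine ⟨Ω, hΩ, hXΩ, fun ψ hψ hs => ?_⟩
      rw [setIntegral_eq_integral_of_forall_compl_eq_zero]
      · exact integral_divergence_eq_zero (contDiff_fun_smul hψ hG) (hasCompactSupport_fun_smul hc _)
      · intro x hx
        exact divergence_zero_of_notMem fun h => hx (hs (tsupport_fun_smul_subset ψ G h))
    rcases hbd X ⟨hX, fun h => hXΩ (interior_subset h)⟩ with h0 | ⟨U, φ, hU, hXU, hφ, hd, hΩU, hN⟩
    · obtain ⟨W, hW, hWo, hXW⟩ := eventually_nhds_iff.1 h0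
      refine ⟨W, hWo, hXW, fun ψ hψ hs => ?_⟩
      have : (fun y => ψ y • G y) = fun _ => 0 := by
        funext y
        by_cases hy : y ∈ W
        · simp [hW y hy]
        · simp [image_eq_zero_of_notMem_tsupport fun h => hy (hs h)]
      simp [this, divergence]
    -- A direction transversal to the surface at `X` stays transversal nearby, and the neighbourhood
    -- is shrunk accordingly.
    · obtain ⟨e, he⟩ : ∃ e, 0 < fderiv ℝ φ X e := by
        by_contra! hneg
        refine hd (ContinuousLinearMap.ext fun v => le_antisymm (hneg v) ?_)
        have := hneg (-v)
        rw [map_neg] at this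
        simpa using this
      have hcont : ContinuousOn (fun y => fderiv ℝ φ y e) U :=
        (hφ.continuousOn_fderiv_of_isOpen hU (by norm_num)).clm_apply continuousOn_const
      refine ⟨U ∩ (fun y => fderiv ℝ φ y e) ⁻¹' Ioi 0, hcont.isOpen_inter_preimage hU isOpen_Ioi,
        ⟨hXU, he⟩, fun ψ hψ hs => ?_⟩
      refine setIntegral_divergence_of_local hΩ.measurableSet
        (hcont.isOpen_inter_preimage hU isOpen_Ioi) (hφ.mono inter_subset_left) ?_
        (fun y hy => hy.2) (contDiff_fun_smul hψ hG) (hasCompactSupport_fun_smul hc _)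
        ((tsupport_fun_smul_subset ψ G).trans hs)
        (fun y hy hyf => by simp [hN y hy.1 hyf])
      ext y
      have := Set.ext_iff.1 hΩU y
      simp only [mem_inter_iff, mem_ofPred_eq] at this ⊢
      tauto
  choose! W hWo hXW hW using hloc
  have hK : IsCompact (closure Ω) := hb.isCompact_closure
  obtain ⟨t, htK, ht⟩ := hK.elim_nhds_subcover W fun X hX => (hWo X hX).mem_nhds (hXW X hX)
  obtain ⟨f, hf⟩ := SmoothPartitionOfUnity.exists_isSubordinate (ι := t) 𝓘(ℝ, E3)
    (isClosed_closure (s := Ω)) (fun i => W i) (fun i => hWo _ (htK _ i.2)) (by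
      simpa [iUnion_subtype] using ht)
  have hfs : ∀ i, ContDiff ℝ 1 (f i) := fun i =>
    ((f i).contMDiff.contDiff).of_le (by exact_mod_cast le_top)
  have hsum : ∀ x ∈ Ω, divergence G x = ∑ i, divergence (fun y => f i y • G y) x := by
    intro x hx
    have h1 : ∀ y ∈ Ω, ∑ i, f i y = 1 := fun y hy => by
      rw [← finsum_eq_sum_of_fintype]
      exact f.sum_eq_one (subset_closure hy)
    have hfd : ∀ i, DifferentiableAt ℝ (f i) x := fun i =>
      (hfs i).differentiable (by norm_num) x
    -- The partition sums to `1` on the open set `Ω`, so the gradients cancel.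
    have h2 : ∑ i, fderiv ℝ (f i) x = 0 := by
      have : (fun y => ∑ i, f i y) =ᶠ[𝓝 x] fun _ => 1 := by
        filter_upwards [hΩ.mem_nhds hx] with y hy using h1 y hy
      have h := this.fderiv_eq (𝕜 := ℝ)
      rw [fderiv_fun_sum fun i _ => hfd i] at h
      simpa using h
    simp_rw [fun i => divergence_smul (hfd i) (hG.differentiable (by norm_num) x)]
    rw [Finset.sum_add_distrib, ← Finset.sum_mul, h1 x hx, ← _root_.sum_apply, h2]
    simp
  rw [setIntegral_congr_fun hΩ.measurableSet hsum, integral_finsetSum]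
  · exact Finset.sum_eq_zero fun i _ => hW _ (htK _ i.2) _ (hfs i) (hf i)
  · intro i _
    exact (integrable_divergence (contDiff_fun_smul (hfs i) hG) (hasCompactSupport_fun_smul hc _)).integrableOn

/-- At almost every point of the zero set, namely at its density points, the whole derivative of `G`
vanishes. -/
theorem ae_divergence_eq_zero {G : E3 → E3} (hG : ContDiff ℝ 1 G) :
    ∀ᵐ x : E3, G x = 0 → divergence G x = 0 := by
  have hm : MeasurableSet {x | G x = 0} := (isClosed_singleton.preimage hG.continuous).measurableSet
  have hA : ApproximatesLinearOn G (0 : E3 →L[ℝ] E3) {x | G x = 0} 0 := by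
    intro x hx y hy
    simp only [mem_ofPred_eq] at hx hy
    simp [hx, hy]
  have := hA.norm_fderiv_sub_le volume hm (fderiv ℝ G) fun x _ =>
    (hG.differentiable (by norm_num) x).hasFDerivAt.hasFDerivWithinAt
  rw [ae_restrict_iff' hm] at this
  filter_upwards [this] with x hx h0
  have h1 := hx h0
  have h2 : fderiv ℝ G x = 0 := by simpa using h1
  simp [divergence, h2]

/-- `G` is replaced by `step (n |G|²) G`, which vanishes in a neighbourhood of every zero of `G`. No
regularity of the boundary is then needed at such zeros, and dominated convergence returns to `G`.
-/
theorem setIntegral_divergence_of_compactSupport {Ω : Set E3} (hΩ : IsOpen Ω)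
    (hb : Bornology.IsBounded Ω) {G : E3 → E3} (hG : ContDiff ℝ 1 G) (hc : HasCompactSupport G)
    (hbd : ∀ X ∈ frontier Ω, G X = 0 ∨ IsTangentialAt Ω G X) :
    ∫ x in Ω, divergence G x = 0 := by
  have hGd : Differentiable ℝ G := hG.differentiable (by norm_num)
  set q : ℕ → E3 → ℝ := fun n x => n * ‖G x‖ ^ 2 with hq
  have hqs : ∀ n, ContDiff ℝ 1 (q n) := fun n => contDiff_const.mul (hG.norm_sq ℝ)
  set ψ : ℕ → E3 → ℝ := fun n x => step (q n x) with hψdef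
  have hψ : ∀ n, ContDiff ℝ 1 (ψ n) := fun n => contDiff_step.comp (hqs n)
  have hev0 : ∀ n x, G x = 0 → ∀ᶠ y in 𝓝 x, ψ n y • G y = 0 := by
    intro n x hx
    have : ∀ᶠ y in 𝓝 x, q n y < 1 :=
      (hqs n).continuous.continuousAt.eventually_lt_const (by simp [hq, hx])
    filter_upwards [this] with y hy
    simp [hψdef, step_of_le hy.le]
  have hzero : ∀ n, ∫ x in Ω, divergence (fun y => ψ n y • G y) x = 0 := by
    intro n
    refine setIntegral_divergence_of_eventually hΩ hb (contDiff_fun_smul (hψ n) hG) (hasCompactSupport_fun_smul hc _) fun X hX => ?_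
    rcases hbd X hX with h | h
    · exact Or.inl (hev0 n X h)
    · exact Or.inr (h.smul _)
  obtain ⟨M, hM0, hM⟩ := exists_deriv_step_le
  have hbound : ∀ n x, ‖divergence (fun y => ψ n y • G y) x‖
      ≤ |divergence G x| + 4 * M * ‖fderiv ℝ G x‖ := by
    intro n x
    rw [divergence_smul ((hψ n).differentiable (by norm_num) x) (hGd x), Real.norm_eq_abs]
    refine (abs_add_le _ _).trans (add_le_add ?_ ?_)
    · rw [abs_mul, abs_of_nonneg (step_nonneg _)]
      exact mul_le_of_le_one_left (abs_nonneg _) (step_le_one _)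
    -- The derivative of the cutoff along `G` is `step' (n |G|²) · 2n ⟨G, DG G⟩`. It vanishes unless
    -- `n |G|² ≤ 2`, and is therefore at most `4 M ‖DG‖`, uniformly in `n`.
    · rw [hψdef, fderiv_step_comp ((hqs n).differentiable (by norm_num) x)]
      by_cases h2 : 2 < q n x
      · rw [deriv_step_of_gt h2, zero_mul, abs_zero]; positivity
      have hd : fderiv ℝ (q n) x (G x) = n * (2 * inner ℝ (G x) (fderiv ℝ G x (G x))) := by
        have h1 := ((hGd x).hasFDerivAt.norm_sq).const_mul (n : ℝ)
        have h3 : fderiv ℝ (q n) x = _ := h1.fderiv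
        rw [h3]; simp
      rw [hd, abs_mul, abs_of_nonneg (deriv_step_nonneg _), abs_mul, Nat.abs_cast, abs_mul,
        abs_two]
      have h4 := (abs_real_inner_le_norm (G x) (fderiv ℝ G x (G x))).trans
        (mul_le_mul_of_nonneg_left ((fderiv ℝ G x).le_opNorm (G x)) (norm_nonneg _))
      calc deriv step (q n x) * (n * (2 * |inner ℝ (G x) (fderiv ℝ G x (G x))|))
          ≤ M * (n * (2 * (‖G x‖ * (‖fderiv ℝ G x‖ * ‖G x‖)))) := by
            have := hM (q n x)
            gcongr
        _ = 2 * M * ‖fderiv ℝ G x‖ * q n x := by simp only [hq]; ring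
        _ ≤ 2 * M * ‖fderiv ℝ G x‖ * 2 :=
            mul_le_mul_of_nonneg_left (not_lt.1 h2) (by positivity)
        _ = _ := by ring
  have hint : Integrable fun x => |divergence G x| + 4 * M * ‖fderiv ℝ G x‖ := by
    refine (integrable_divergence hG hc).abs.add (Integrable.const_mul ?_ _)
    exact ((hG.continuous_fderiv (by norm_num)).integrable_of_hasCompactSupport
      (hc.fderiv ℝ)).norm
  have hlim : Tendsto (fun n => ∫ x in Ω, divergence (fun y => ψ n y • G y) x) atTop
      (𝓝 (∫ x in Ω, divergence G x)) := by
    refine tendsto_integral_of_dominated_convergence _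
      (fun n => (continuous_divergence (contDiff_fun_smul (hψ n) hG)).aestronglyMeasurable) hint.integrableOn
      (fun n => Eventually.of_forall (hbound n)) ?_
    -- On the zero set the approximating divergences are all `0`, and so is the limit, almost
    -- everywhere.
    filter_upwards [ae_restrict_of_ae (ae_divergence_eq_zero hG)] with x hx
    by_cases h0 : G x = 0
    · rw [hx h0]
      exact tendsto_const_nhds.congr fun n => (divergence_zero_of_eventually (hev0 n x h0)).symm
    · refine tendsto_const_nhds.congr' ?_
      have hp : 0 < ‖G x‖ ^ 2 := by positivity
      obtain ⟨N, hN⟩ := exists_nat_gt (2 / ‖G x‖ ^ 2)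
      filter_upwards [eventually_ge_atTop N] with n hn
      have h4 : 2 < q n x := by
        rw [div_lt_iff₀ hp] at hN
        have : (N : ℝ) ≤ n := by exact_mod_cast hn
        simp only [hq]
        nlinarith
      refine divergence_congr ?_
      filter_upwards [(hqs n).continuous.continuousAt.eventually_const_lt h4] with y hy
      simp [hψdef, step_of_ge hy.le]
  exact tendsto_nhds_unique hlim (by simp [hzero])

/-- The divergence theorem for a field that at each boundary point either vanishes or is
tangential to a `C¹` boundary. -/
theorem setIntegral_divergence_eq_zero {Ω O : Set E3} (hΩ : IsOpen Ω)
    (hb : Bornology.IsBounded Ω) (hO : IsOpen O) (hΩO : closure Ω ⊆ O) {G : E3 → E3}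
    (hG : ContDiffOn ℝ 1 G O) (hbd : ∀ X ∈ frontier Ω, G X = 0 ∨ IsTangentialAt Ω G X) :
    IntegrableOn (divergence G) Ω ∧ ∫ x in Ω, divergence G x = 0 := by
  obtain ⟨κ, hκ, hκc, hκO, hκ1, -⟩ := exists_cutoff hb.isCompact_closure hO hΩO
  have hs := contDiff_cutoff_smul hO (hκ.of_le (by norm_num)) hκO hG
  have heq : ∀ x ∈ Ω, divergence (fun y => κ y • G y) x = divergence G x := by
    intro x hx
    refine divergence_congr ?_
    filter_upwards [eventually_nhdsSet_iff_forall.1 hκ1 x (subset_closure hx)] with y hy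
    simp [hy]
  constructor
  · exact ((integrable_divergence hs hκc.smul_right).integrableOn).congr_fun heq hΩ.measurableSet
  · rw [← setIntegral_congr_fun hΩ.measurableSet heq]
    refine setIntegral_divergence_of_compactSupport hΩ hb hs hκc.smul_right fun X hX => ?_
    rcases hbd X hX with h | h
    · exact Or.inl (by simp [h])
    · exact Or.inr (h.smul κ)

/-! ### Korn-Poincaré inequality by integration along segments -/

theorem sq_lintegral_Ioc_le (f : ℝ → ℝ≥0∞) (hf : Measurable f) :
    (∫⁻ s in Ioc (0 : ℝ) 1, f s) ^ 2 ≤ ∫⁻ s in Ioc (0 : ℝ) 1, f s ^ 2 := by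
  have h := ENNReal.lintegral_mul_le_Lp_mul_Lq (volume.restrict (Ioc (0 : ℝ) 1))
    Real.HolderConjugate.two_two hf.aemeasurable (aemeasurable_const (b := (1 : ℝ≥0∞)))
  have h1 : (∫⁻ s in Ioc (0 : ℝ) 1, f s) ≤ (∫⁻ s in Ioc (0 : ℝ) 1, f s ^ (2 : ℝ)) ^ (1 / 2 : ℝ) := by
    simpa using h
  have h2 := ENNReal.rpow_le_rpow h1 (show (0 : ℝ) ≤ 2 by norm_num)
  rw [← ENNReal.rpow_mul] at h2
  norm_num at h2
  exact_mod_cast h2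

/-- The Jacobian factor of the substitution is `s⁻³ ≤ 8`. -/
theorem lintegral_comp_add_smul (F : E3 → ℝ≥0∞) (hF : Measurable F) (c : E3) {s : ℝ}
    (hs : 1 / 2 ≤ s) : ∫⁻ x, F (c + s • x) ≤ 8 * ∫⁻ x, F x := by
  have hs0 : s ≠ 0 := by linarith
  have h1 : ∫⁻ x, F (c + s • x) = ∫⁻ y, F (c + y) ∂(Measure.map (s • ·) (volume : Measure E3)) := by
    rw [lintegral_map (by fun_prop) (by fun_prop)]
  rw [h1, Measure.map_addHaar_smul _ hs0, lintegral_smul_measure, lintegral_add_left_eq_self]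
  rw [smul_eq_mul]
  gcongr
  rw [show (8 : ℝ≥0∞) = ENNReal.ofReal 8 by norm_num]
  refine ENNReal.ofReal_le_ofReal ?_
  have h3 : Module.finrank ℝ E3 = 3 := by simp
  rw [h3, abs_of_nonneg (by positivity)]
  have : (1 / 8 : ℝ) ≤ s ^ 3 := by
    have := pow_le_pow_left₀ (by norm_num) hs 3
    norm_num at this ⊢
    linarith
  calc (s ^ 3)⁻¹ ≤ (1 / 8 : ℝ)⁻¹ := inv_anti₀ (by norm_num) this
    _ = 8 := by norm_num

theorem exists_ball_inner_ge (a x x₀ : E3) {r : ℝ} (hr : 0 < r) :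
    ∃ c, Metric.ball c (r / 4) ⊆ Metric.ball x₀ r ∧
      ∀ y ∈ Metric.ball c (r / 4), r / 4 * ‖a‖ ≤ |inner ℝ a (x - y)| := by
  by_cases ha : a = 0
  · exact ⟨x₀, Metric.ball_subset_ball (by linarith), by simp [ha]⟩
  have hna : 0 < ‖a‖ := norm_pos_iff.2 ha
  have key : ∀ σ : ℝ, |σ| = 1 → 0 ≤ σ * inner ℝ a (x - x₀) →
      ∃ c, Metric.ball c (r / 4) ⊆ Metric.ball x₀ r ∧
      ∀ y ∈ Metric.ball c (r / 4), r / 4 * ‖a‖ ≤ |inner ℝ a (x - y)| := by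
    intro σ hσ hpos
    -- The centre moves from `x₀` by `r/2` along `∓a`, the sign being chosen to increase `|⟨a, x -
    -- x₀⟩|`. This gains `r/2 ‖a‖`, of which at most `r/4 ‖a‖` is lost on a ball of radius `r/4`.
    set b : E3 := (σ * (r / 2) * ‖a‖⁻¹) • a with hb
    have hnb : ‖b‖ = r / 2 := by
      rw [hb, norm_smul, Real.norm_eq_abs, abs_mul, abs_mul, hσ, abs_of_pos (half_pos hr),
        abs_of_pos (inv_pos.2 hna)]
      field_simp
    refine ⟨x₀ - b, fun y hy => ?_, fun y hy => ?_⟩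
    · rw [Metric.mem_ball, dist_eq_norm] at hy ⊢
      calc ‖y - x₀‖ = ‖(y - (x₀ - b)) - b‖ := by congr 1; abel
        _ ≤ ‖y - (x₀ - b)‖ + ‖b‖ := norm_sub_le _ _
        _ < r := by rw [hnb]; linarith
    · rw [Metric.mem_ball, dist_eq_norm] at hy
      have h1 : x - y = (x - x₀) + b - (y - (x₀ - b)) := by abel
      have h2 : inner ℝ a b = σ * (r / 2) * ‖a‖ := by
        rw [hb, inner_smul_right, real_inner_self_eq_norm_sq]
        field_simp
      have h3 := (abs_real_inner_le_norm a (y - (x₀ - b))).trans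
        (mul_le_mul_of_nonneg_left hy.le hna.le)
      have hσσ : σ * σ = 1 := by rw [← abs_mul_abs_self, hσ, one_mul]
      have h4 : σ * inner ℝ a (y - (x₀ - b)) ≤ ‖a‖ * (r / 4) := by
        refine (le_abs_self _).trans ?_
        rwa [abs_mul, hσ, one_mul]
      have h5 : σ * inner ℝ a (x - y) ≤ |inner ℝ a (x - y)| := by
        refine (le_abs_self _).trans ?_
        rw [abs_mul, hσ, one_mul]
      rw [h1, inner_sub_right, inner_add_right, h2] at h5 ⊢
      refine le_trans ?_ h5
      have h6 : σ * (σ * (r / 2) * ‖a‖) = r / 2 * ‖a‖ := by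
        rw [← mul_assoc, ← mul_assoc, hσσ, one_mul]
      rw [mul_sub, mul_add, h6]
      linarith
  rcases le_total 0 (inner ℝ a (x - x₀)) with h | h
  · exact key 1 (by simp) (by simpa using h)
  · exact key (-1) (by simp) (by simpa using h)

theorem mul_sq_norm_le_lintegral_inner (a x x₀ : E3) {r : ℝ} (hr : 0 < r) :
    ENNReal.ofReal (r / 4) ^ 2 * volume (Metric.ball (0 : E3) (r / 4)) * ‖a‖ₑ ^ 2
      ≤ ∫⁻ y in Metric.ball x₀ r, ‖inner ℝ a (x - y)‖ₑ ^ 2 := by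
  obtain ⟨c, hc, hy⟩ := exists_ball_inner_ge a x x₀ hr
  calc ENNReal.ofReal (r / 4) ^ 2 * volume (Metric.ball (0 : E3) (r / 4)) * ‖a‖ₑ ^ 2
      = ∫⁻ y in Metric.ball c (r / 4), (ENNReal.ofReal (r / 4) * ‖a‖ₑ) ^ 2 := by
        rw [setLIntegral_const, Measure.addHaar_ball_center volume c]
        ring
    _ ≤ ∫⁻ y in Metric.ball c (r / 4), ‖inner ℝ a (x - y)‖ₑ ^ 2 := by
        refine setLIntegral_mono' Metric.isOpen_ball.measurableSet fun y hyc => ?_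
        gcongr
        have := hy y hyc
        rw [← ofReal_norm a, ← ENNReal.ofReal_mul (by positivity),
          Real.enorm_eq_ofReal_abs]
        exact ENNReal.ofReal_le_ofReal this
    _ ≤ _ := lintegral_mono_set hc

/-- The quadratic form of the strain, integrated along a segment from a zero of `u`. -/
theorem enorm_inner_sq_le_lintegral_segment {W : Set E3} {u : E3 → E3} {L : E3 → E3 →L[ℝ] E3}
    {d : E3 → ℝ} {x y : E3} {b : ℝ}
    (hu : ∀ z ∈ W, HasFDerivAt u (L z) z) (hL : ContinuousOn L W) (hu0 : ∀ z ∉ W, u z = 0)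
    (hd : Measurable d) (hdb : ∀ z, d z ≤ b)
    (hdL : ∀ z ∈ W, ∀ a, |inner ℝ (L z a) a| ≤ d z * ‖a‖ ^ 2)
    (hy : u y = 0) (hc : ∀ z ∈ segment ℝ y x, ContinuousAt u z) :
    ‖inner ℝ (u x) (x - y)‖ₑ ^ 2
      ≤ ‖x - y‖ₑ ^ 4 * ∫⁻ s in Ioc (0 : ℝ) 1, ENNReal.ofReal (d (y + s • (x - y))) ^ 2 := by
  set z : ℝ → E3 := fun s => y + s • (x - y) with hz
  have hzc : Continuous z := by fun_prop
  have hzs : ∀ s ∈ Icc (0 : ℝ) 1, z s ∈ segment ℝ y x := fun s hs => by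
    rw [segment_eq_image']; exact ⟨s, hs, rfl⟩
  set g : ℝ → ℝ := fun s => inner ℝ (u (z s)) (x - y) with hg
  have hgc : ContinuousOn g (Icc 0 1) := fun s hs =>
    (((hc _ (hzs s hs)).comp hzc.continuousAt).inner continuousAt_const).continuousWithinAt
  set S : Set ℝ := Icc (0 : ℝ) 1 ∩ g ⁻¹' {0} with hS
  have hSc : IsCompact S := isCompact_Icc.of_isClosed_subset
    (hgc.preimage_isClosed_of_isClosed isClosed_Icc isClosed_singleton) inter_subset_left
  have hS0 : (0 : ℝ) ∈ S := ⟨by simp, by simp [hg, hz, hy]⟩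
  -- The segment may leave `W`, where `u` need not be differentiable. Beyond the last zero `σ` of
  -- `g` it stays in `W`, since `u = 0` off `W`, so the fundamental theorem of calculus is applied
  -- on `[σ, 1]` only.
  obtain ⟨σ, hσ⟩ := hSc.exists_isGreatest ⟨0, hS0⟩
  have hσI : σ ∈ Icc (0 : ℝ) 1 := hσ.1.1
  have hgσ : g σ = 0 := hσ.1.2
  have hW : ∀ s ∈ Ioc σ 1, z s ∈ W := by
    intro s hs
    by_contra h
    have : s ∈ S := ⟨⟨hσI.1.trans hs.1.le, hs.2⟩, by simp [hg, hu0 _ h]⟩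
    exact absurd (hσ.2 this) (not_le.2 hs.1)
  set g' : ℝ → ℝ := fun s => inner ℝ (L (z s) (x - y)) (x - y) with hg'
  have hder : ∀ s ∈ Ioo σ 1, HasDerivAt g (g' s) s := by
    intro s hs
    have h1 : HasDerivAt z (x - y) s := by
      simpa [hz] using ((hasDerivAt_id s).smul_const (x - y)).const_add y
    have h2 := (hu _ (hW s ⟨hs.1, hs.2.le⟩)).comp_hasDerivAt s h1
    have h3 := h2.inner ℝ (hasDerivAt_const s (x - y))
    rw [inner_zero_right, zero_add] at h3
    exact h3
  have hg'c : ContinuousOn g' (Ioc σ 1) := by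
    have h1 : ContinuousOn (fun s => L (z s)) (Ioc σ 1) :=
      hL.comp hzc.continuousOn fun s hs => hW s hs
    exact (h1.clm_apply continuousOn_const).inner continuousOn_const
  have hg'b : ∀ s ∈ Ioc σ 1, |g' s| ≤ d (z s) * ‖x - y‖ ^ 2 := fun s hs => hdL _ (hW s hs) _
  have hint : IntervalIntegrable g' volume σ 1 := by
    rw [intervalIntegrable_iff_integrableOn_Ioc_of_le hσI.2]
    refine Integrable.of_bound (hg'c.aestronglyMeasurable measurableSet_Ioc)
      (b * ‖x - y‖ ^ 2) ?_
    rw [ae_restrict_iff' measurableSet_Ioc]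
    refine Eventually.of_forall fun s hs => (hg'b s hs).trans ?_
    exact mul_le_mul_of_nonneg_right (hdb _) (by positivity)
  have hftc := intervalIntegral.integral_eq_sub_of_hasDerivAt_of_le hσI.2
    (hgc.mono (Icc_subset_Icc_left hσI.1)) hder hint
  rw [hgσ, sub_zero, intervalIntegral.integral_of_le hσI.2] at hftc
  have hg1 : g 1 = inner ℝ (u x) (x - y) := by simp [hg, hz]
  rw [← hg1, ← hftc]
  have hm : Measurable fun s => ENNReal.ofReal (d (z s)) := (hd.comp hzc.measurable).ennreal_ofReal
  calc ‖∫ s in Ioc σ 1, g' s‖ₑ ^ 2 ≤ (∫⁻ s in Ioc σ 1, ‖g' s‖ₑ) ^ 2 := by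
        gcongr; exact enorm_integral_le_lintegral_enorm _
    _ ≤ (∫⁻ s in Ioc σ 1, ‖x - y‖ₑ ^ 2 * ENNReal.ofReal (d (z s))) ^ 2 := by
        gcongr 1
        refine setLIntegral_mono' measurableSet_Ioc fun s hs => ?_
        rw [Real.enorm_eq_ofReal_abs, ← ofReal_norm (x - y),
          ← ENNReal.ofReal_pow (norm_nonneg _), ← ENNReal.ofReal_mul (by positivity), mul_comm]
        exact ENNReal.ofReal_le_ofReal (hg'b s hs)
    _ ≤ (∫⁻ s in Ioc 0 1, ‖x - y‖ₑ ^ 2 * ENNReal.ofReal (d (z s))) ^ 2 := by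
        gcongr 1
        exact lintegral_mono_set (Ioc_subset_Ioc_left hσI.1)
    _ = ‖x - y‖ₑ ^ 4 * (∫⁻ s in Ioc 0 1, ENNReal.ofReal (d (z s))) ^ 2 := by
        rw [lintegral_const_mul _ hm]; ring
    _ ≤ _ := by
        gcongr
        exact sq_lintegral_Ioc_le _ hm

/-- For fixed `s`, substitute in whichever of `x` and `y` has coefficient (`s` or `1 - s`) at least
`1/2`; the integral over the other variable contributes the volume of its domain. -/
theorem lintegral_lintegral_segment_le {W B : Set E3} {F : E3 → ℝ≥0∞} (hF : Measurable F) :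
    ∫⁻ x in W, ∫⁻ y in B, ∫⁻ s in Ioc (0 : ℝ) 1, F (y + s • (x - y))
      ≤ 8 * (volume B + volume W) * ∫⁻ z, F z := by
  have hJ : Measurable fun q : (E3 × E3) × ℝ => F (q.1.2 + q.2 • (q.1.1 - q.1.2)) :=
    hF.comp (by fun_prop)
  have hs : ∀ s ∈ Ioc (0 : ℝ) 1, ∫⁻ x in W, ∫⁻ y in B, F (y + s • (x - y))
      ≤ 8 * (volume B + volume W) * ∫⁻ z, F z := by
    intro s hs
    rcases le_total (1 / 2) s with h | h
    · calc ∫⁻ x in W, ∫⁻ y in B, F (y + s • (x - y))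
          = ∫⁻ y in B, ∫⁻ x in W, F (y + s • (x - y)) := by
            refine lintegral_lintegral_swap (Measurable.aemeasurable ?_)
            exact hF.comp (by fun_prop)
        _ ≤ ∫⁻ y in B, 8 * ∫⁻ z, F z := by
            refine lintegral_mono fun y => (setLIntegral_le_lintegral _ _).trans ?_
            refine le_trans (le_of_eq ?_) (lintegral_comp_add_smul F hF (y - s • y) h)
            refine lintegral_congr fun x => ?_
            congr 1
            rw [smul_sub]; abel
        _ = 8 * volume B * ∫⁻ z, F z := by rw [setLIntegral_const]; ring
        _ ≤ _ := by gcongr; exact le_self_add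
    · calc ∫⁻ x in W, ∫⁻ y in B, F (y + s • (x - y)) ≤ ∫⁻ x in W, 8 * ∫⁻ z, F z := by
            refine lintegral_mono fun x => (setLIntegral_le_lintegral _ _).trans ?_
            refine le_trans (le_of_eq ?_)
              (lintegral_comp_add_smul F hF (s • x) (s := 1 - s) (by linarith))
            refine lintegral_congr fun y => ?_
            congr 1
            rw [smul_sub, sub_smul, one_smul]; abel
        _ = 8 * volume W * ∫⁻ z, F z := by rw [setLIntegral_const]; ring
        _ ≤ _ := by gcongr; exact le_add_self
  calc ∫⁻ x in W, ∫⁻ y in B, ∫⁻ s in Ioc (0 : ℝ) 1, F (y + s • (x - y))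
      = ∫⁻ x in W, ∫⁻ s in Ioc (0 : ℝ) 1, ∫⁻ y in B, F (y + s • (x - y)) := by
        refine lintegral_congr fun x => lintegral_lintegral_swap (Measurable.aemeasurable ?_)
        exact hF.comp (by fun_prop)
    _ = ∫⁻ s in Ioc (0 : ℝ) 1, ∫⁻ x in W, ∫⁻ y in B, F (y + s • (x - y)) := by
        refine lintegral_lintegral_swap (Measurable.aemeasurable ?_)
        refine Measurable.lintegral_prod_right' (f := fun q : (E3 × ℝ) × E3 =>
          F (q.2 + q.1.2 • (q.1.1 - q.2))) (ν := volume.restrict B) ?_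
        exact hF.comp (by fun_prop)
    _ ≤ ∫⁻ s in Ioc (0 : ℝ) 1, 8 * (volume B + volume W) * ∫⁻ z, F z :=
        setLIntegral_mono' measurableSet_Ioc hs
    _ = _ := by simp

/-- A Korn-Poincaré inequality on a domain that is star-shaped, together with a set on which the
field vanishes, about the points of a ball. -/
theorem korn_poincare {W A : Set E3} {u : E3 → E3} {L : E3 → E3 →L[ℝ] E3} {d : E3 → ℝ} {x₀ : E3}
    {r R b : ℝ} (hr : 0 < r) (hW : IsOpen W) (hWR : W ⊆ Metric.closedBall x₀ R)
    (hu : ∀ z ∈ W, HasFDerivAt u (L z) z) (hL : ContinuousOn L W) (hu0 : ∀ z ∉ W, u z = 0)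
    (hd : Measurable d) (hdb : ∀ z, d z ≤ b)
    (hdL : ∀ z ∈ W, ∀ a, |inner ℝ (L z a) a| ≤ d z * ‖a‖ ^ 2)
    (hA : Metric.ball x₀ r ⊆ A) (huA : ∀ z ∈ A, u z = 0 ∧ ContinuousAt u z)
    (hseg : ∀ y ∈ Metric.ball x₀ r, ∀ x ∈ W, segment ℝ y x ⊆ W ∪ A) :
    ENNReal.ofReal (r / 4) ^ 2 * volume (Metric.ball (0 : E3) (r / 4)) * ∫⁻ x in W, ‖u x‖ₑ ^ 2
      ≤ ENNReal.ofReal (|R| + r) ^ 4 * (8 * (volume (Metric.ball (0 : E3) r)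
        + volume (Metric.closedBall (0 : E3) R))) * ∫⁻ x, ENNReal.ofReal (d x) ^ 2 := by
  have hF : Measurable fun z => ENNReal.ofReal (d z) ^ 2 := hd.ennreal_ofReal.pow_const 2
  have hvW : volume W ≤ volume (Metric.closedBall (0 : E3) R) := by
    rw [← Measure.addHaar_closedBall_center volume x₀]
    exact measure_mono hWR
  have hc1 : ENNReal.ofReal (r / 4) ^ 2 * volume (Metric.ball (0 : E3) (r / 4)) ≠ ⊤ :=
    ENNReal.mul_ne_top (by simp) measure_ball_lt_top.ne
  rw [← lintegral_const_mul' _ _ hc1]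
  calc ∫⁻ x in W, ENNReal.ofReal (r / 4) ^ 2 * volume (Metric.ball (0 : E3) (r / 4)) * ‖u x‖ₑ ^ 2
      ≤ ∫⁻ x in W, ∫⁻ y in Metric.ball x₀ r, ENNReal.ofReal (|R| + r) ^ 4 *
          ∫⁻ s in Ioc (0 : ℝ) 1, ENNReal.ofReal (d (y + s • (x - y))) ^ 2 := by
        refine setLIntegral_mono' hW.measurableSet fun x hx => ?_
        refine (mul_sq_norm_le_lintegral_inner (u x) x x₀ hr).trans ?_
        refine setLIntegral_mono' Metric.isOpen_ball.measurableSet fun y hy => ?_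
        -- Continuity of `u` along the segment holds by differentiability in `W` and by hypothesis
        -- on `A`; these two sets cover the segment.
        refine (enorm_inner_sq_le_lintegral_segment hu hL hu0 hd hdb hdL (huA y (hA hy)).1
          fun z hz => ?_).trans ?_
        · rcases hseg y hy x hx hz with h | h
          · exact (hu z h).continuousAt
          · exact (huA z h).2
        · gcongr
          rw [← ofReal_norm]
          refine ENNReal.ofReal_le_ofReal ?_
          have h1 := hWR hx
          rw [Metric.mem_closedBall, dist_eq_norm] at h1
          rw [Metric.mem_ball, dist_eq_norm] at hy
          calc ‖x - y‖ = ‖(x - x₀) - (y - x₀)‖ := by congr 1; abel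
            _ ≤ ‖x - x₀‖ + ‖y - x₀‖ := norm_sub_le _ _
            _ ≤ |R| + r := add_le_add (h1.trans (le_abs_self R)) hy.le
    _ = ENNReal.ofReal (|R| + r) ^ 4 * ∫⁻ x in W, ∫⁻ y in Metric.ball x₀ r,
          ∫⁻ s in Ioc (0 : ℝ) 1, ENNReal.ofReal (d (y + s • (x - y))) ^ 2 := by
        rw [← lintegral_const_mul' _ _ (by simp)]
        refine lintegral_congr fun x => ?_
        rw [lintegral_const_mul' _ _ (by simp)]
    _ ≤ ENNReal.ofReal (|R| + r) ^ 4 * (8 * (volume (Metric.ball x₀ r) + volume W)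
          * ∫⁻ z, ENNReal.ofReal (d z) ^ 2) := by
        gcongr
        exact lintegral_lintegral_segment_le hF
    _ ≤ _ := by
        rw [Measure.addHaar_ball_center volume x₀, mul_assoc (ENNReal.ofReal (|R| + r) ^ 4)]
        gcongr

/-! ### Matrix calculus: cofactors, Piola identity, stress power -/

/-- The partial derivative in the `j`-th coordinate direction. -/
def pderiv (j : Fin 3) (g : E3 → ℝ) (X : E3) : ℝ := fderiv ℝ g X (EuclideanSpace.single j 1)

theorem pderiv_mul {f g : E3 → ℝ} {X : E3} (hf : DifferentiableAt ℝ f X)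
    (hg : DifferentiableAt ℝ g X) (j : Fin 3) :
    pderiv j (fun Y => f Y * g Y) X = pderiv j f X * g X + f X * pderiv j g X := by
  unfold pderiv
  rw [fderiv_fun_mul hf hg]
  simp; ring

theorem pderiv_sub {f g : E3 → ℝ} {X : E3} (hf : DifferentiableAt ℝ f X)
    (hg : DifferentiableAt ℝ g X) (j : Fin 3) :
    pderiv j (fun Y => f Y - g Y) X = pderiv j f X - pderiv j g X := by
  unfold pderiv
  rw [fderiv_fun_sub hf hg]
  simp

theorem pderiv_sum {f : Fin 3 → E3 → ℝ} {X : E3} (hf : ∀ i, DifferentiableAt ℝ (f i) X)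
    (j : Fin 3) : pderiv j (fun Y => ∑ i, f i Y) X = ∑ i, pderiv j (f i) X := by
  unfold pderiv
  rw [fderiv_fun_sum fun i _ => hf i]
  simp

theorem jac_eq_pderiv {f : E3 → E3} {X : E3} (hf : DifferentiableAt ℝ f X) (i j : Fin 3) :
    jac f X i j = pderiv j (fun Y => f Y i) X := by
  have := ((EuclideanSpace.proj (𝕜 := ℝ) i : E3 →L[ℝ] ℝ).hasFDerivAt.comp X hf.hasFDerivAt).fderiv
  have h2 : ((EuclideanSpace.proj (𝕜 := ℝ) i : E3 →L[ℝ] ℝ) ∘ f) = fun y => f y i := rfl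
  rw [h2] at this
  rw [pderiv, this]
  rfl

theorem jac_mulVec {f : E3 → E3} {X : E3} (a : E3) : jac f X *ᵥ ⇑a = ⇑(fderiv ℝ f X a) := by
  funext i
  conv_rhs => rw [← sum_coord_smul_single a]
  simp [jac, mulVec, dotProduct, mul_comm]

theorem divergence_eq_sum_pderiv {G : E3 → E3} {X : E3} (hG : DifferentiableAt ℝ G X) :
    divergence G X = ∑ j, pderiv j (fun Y => G Y j) X :=
  Finset.sum_congr rfl fun j _ => jac_eq_pderiv hG j j

/-- With indices taken cyclically modulo 3, the cofactors carry no signs. -/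
theorem adjugate_apply_fin_three (M : Matrix (Fin 3) (Fin 3) ℝ) (j k : Fin 3) :
    M.adjugate j k = M (k + 1) (j + 1) * M (k + 2) (j + 2)
      - M (k + 1) (j + 2) * M (k + 2) (j + 1) := by
  rw [adjugate_fin_three]
  fin_cases j <;> fin_cases k <;> simp <;> ring

/-- Jacobi's formula, by expansion of the determinant. -/
theorem hasDerivAt_det {F : ℝ → Matrix (Fin 3) (Fin 3) ℝ} {F' : Matrix (Fin 3) (Fin 3) ℝ} {t : ℝ}
    (h : ∀ i j, HasDerivAt (fun s => F s i j) (F' i j) t) :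
    HasDerivAt (fun s => (F s).det) (∑ j, ∑ k, (F t).adjugate j k * F' k j) t := by
  simp only [det_fin_three]
  have := ((((((((h 0 0).mul (h 1 1)).mul (h 2 2)).sub (((h 0 0).mul (h 1 2)).mul (h 2 1))).sub
    (((h 0 1).mul (h 1 0)).mul (h 2 2))).add (((h 0 1).mul (h 1 2)).mul (h 2 0))).add
    (((h 0 2).mul (h 1 0)).mul (h 2 1))).sub (((h 0 2).mul (h 1 1)).mul (h 2 0)))
  refine this.congr_deriv ?_
  simp only [Fin.sum_univ_three, adjugate_apply_fin_three, Fin.isValue, Fin.reduceAdd,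
    Pi.mul_apply]
  ring

/-- The Piola identity: the cofactors of a Jacobian matrix are divergence-free. -/
theorem sum_pderiv_adjugate {F : E3 → Matrix (Fin 3) (Fin 3) ℝ} {X : E3}
    (hF : ∀ i j, DifferentiableAt ℝ (fun Y => F Y i j) X)
    (hs : ∀ i j l, pderiv l (fun Y => F Y i j) X = pderiv j (fun Y => F Y i l) X) (k : Fin 3) :
    ∑ j, pderiv j (fun Y => (F Y).adjugate j k) X = 0 := by
  have h : ∀ j, pderiv j (fun Y => (F Y).adjugate j k) X
      = pderiv j (fun Y => F Y (k + 1) (j + 1)) X * F X (k + 2) (j + 2)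
        + F X (k + 1) (j + 1) * pderiv j (fun Y => F Y (k + 2) (j + 2)) X
        - (pderiv j (fun Y => F Y (k + 1) (j + 2)) X * F X (k + 2) (j + 1)
        + F X (k + 1) (j + 2) * pderiv j (fun Y => F Y (k + 2) (j + 1)) X) := by
    intro j
    simp_rw [adjugate_apply_fin_three]
    rw [pderiv_sub ((hF _ _).fun_mul (hF _ _)) ((hF _ _).fun_mul (hF _ _)),
      pderiv_mul (hF _ _) (hF _ _), pderiv_mul (hF _ _) (hF _ _)]
  simp only [h, Fin.sum_univ_three, Fin.isValue, Fin.reduceAdd, zero_add]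
  -- Symmetry brings the mixed derivatives to one order, after which they cancel in pairs.
  rw [hs (k + 1) 1 0, hs (k + 2) 2 0, hs (k + 1) 2 0, hs (k + 2) 1 0, hs (k + 1) 2 1,
    hs (k + 2) 2 1]
  ring

/-- The product rule, in which `hA0` removes every term with a derivative of `A`. It is used with
`P` the Piola stress, `A` the cofactors, `q` the kinetic energy density and `c` the velocity
relative to the reference. -/
theorem divergence_flux {P A : E3 → Matrix (Fin 3) (Fin 3) ℝ} {a c : E3 → E3} {q : E3 → ℝ} {X : E3}
    (hP : ∀ i j, DifferentiableAt ℝ (fun Y => P Y i j) X)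
    (hA : ∀ i j, DifferentiableAt ℝ (fun Y => A Y i j) X)
    (ha : DifferentiableAt ℝ a X) (hc : DifferentiableAt ℝ c X) (hq : DifferentiableAt ℝ q X)
    (hA0 : ∀ k, ∑ j, pderiv j (fun Y => A Y j k) X = 0) :
    divergence (fun Y => WithLp.toLp 2 fun j =>
        (∑ i, P Y i j * a Y i) - q Y * ∑ k, A Y j k * c Y k) X
      = ∑ i, rowDiv P X i * a X i + frob (P X) (jac a X)
        - ∑ j, pderiv j q X * ∑ k, A X j k * c X k
        - q X * ∑ j, ∑ k, A X j k * jac c X k j := by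
  have ha' : ∀ i, DifferentiableAt ℝ (fun Y => a Y i) X := fun i => by fun_prop
  have hc' : ∀ i, DifferentiableAt ℝ (fun Y => c Y i) X := fun i => by fun_prop
  have hG : DifferentiableAt ℝ (fun Y => (WithLp.toLp 2 fun j =>
      (∑ i, P Y i j * a Y i) - q Y * ∑ k, A Y j k * c Y k : E3)) X := by
    rw [differentiableAt_euclidean]
    intro j
    simp only
    fun_prop
  rw [divergence_eq_sum_pderiv hG]
  have h1 : ∀ j, pderiv j (fun Y => (∑ i, P Y i j * a Y i) - q Y * ∑ k, A Y j k * c Y k) X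
      = (∑ i, (pderiv j (fun Y => P Y i j) X * a X i + P X i j * jac a X i j))
        - (pderiv j q X * (∑ k, A X j k * c X k)
          + q X * ∑ k, (pderiv j (fun Y => A Y j k) X * c X k + A X j k * jac c X k j)) := by
    intro j
    rw [pderiv_sub (by fun_prop) (by fun_prop), pderiv_mul (by fun_prop) (by fun_prop),
      pderiv_sum (by fun_prop), pderiv_sum (by fun_prop)]
    simp_rw [fun i => pderiv_mul (hP i j) (ha' i) j, fun k => pderiv_mul (hA j k) (hc' k) j,
      jac_eq_pderiv ha, jac_eq_pderiv hc]
  simp only [h1]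
  have e0 := hA0 0
  have e1 := hA0 1
  have e2 := hA0 2
  simp only [Fin.sum_univ_three, rowDiv, frob] at *
  simp only [pderiv] at *
  linear_combination (-q X * c X 0) * e0 + (-q X * c X 1) * e1 + (-q X * c X 2) * e2

/-- The power of the Piola-Kirchhoff stress in terms of the spatial stress. -/
theorem stress_power {F V S : Matrix (Fin 3) (Fin 3) ℝ} :
    frob (F.det • (S * (F⁻¹)ᵀ)) V = F.det * frob S (V * F⁻¹) := by
  simp only [frob, Matrix.smul_apply, mul_apply, transpose_apply, Fin.sum_univ_three, smul_eq_mul]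
  ring

/-- The pressure does the work `-p tr L`, which vanishes. -/
theorem frob_newtonian {L : Matrix (Fin 3) (Fin 3) ℝ} {p μ : ℝ} (h : L.trace = 0) :
    frob ((-p) • (1 : Matrix (Fin 3) (Fin 3) ℝ) + μ • (L + Lᵀ)) L = μ * frob (L + Lᵀ) L := by
  simp only [trace, diag_apply, Fin.sum_univ_three] at h
  simp [frob, Fin.sum_univ_three, Matrix.one_apply]
  linear_combination (-p) * h

theorem trace_mul_eq_frob (V Z : Matrix (Fin 3) (Fin 3) ℝ) : (V * Z).trace = frob V Zᵀ := by
  simp [trace, frob, mul_apply]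

theorem adjugate_eq_det_mul_inv {F : Matrix (Fin 3) (Fin 3) ℝ} (h : F.det ≠ 0) (j k : Fin 3) :
    F.adjugate j k = F.det * F⁻¹ j k := by
  rw [inv_def, Matrix.smul_apply, Ring.inverse_eq_inv', smul_eq_mul, mul_inv_cancel_left₀ h]

/-! ### Regularity of the motion and of the stress -/

section Slices

variable {F : Type*} [NormedAddCommGroup F] [NormedSpace ℝ F]

theorem hasFDerivAt_slice {f : ℝ → E3 → F} {t : ℝ} {X : E3}
    (h : DifferentiableAt ℝ (Function.uncurry f) (t, X)) :
    HasFDerivAt (f t)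
      ((fderiv ℝ (Function.uncurry f) (t, X)).comp (ContinuousLinearMap.inr ℝ ℝ E3)) X :=
  h.hasFDerivAt.comp X (hasFDerivAt_prodMk_right t X)

theorem hasDerivAt_slice {f : ℝ → E3 → F} {t : ℝ} {X : E3}
    (h : DifferentiableAt ℝ (Function.uncurry f) (t, X)) :
    HasDerivAt (fun s => f s X) (fderiv ℝ (Function.uncurry f) (t, X) (1, 0)) t := by
  have h1 : HasDerivAt (fun s : ℝ => (s, X)) ((1 : ℝ), (0 : E3)) t :=
    (hasDerivAt_id t).prodMk (hasDerivAt_const t X)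
  exact h.hasFDerivAt.comp_hasDerivAt t h1

end Slices

theorem contDiffOn_slice {F : Type*} [NormedAddCommGroup F] [NormedSpace ℝ F] {f : ℝ × E3 → F}
    {O : Set (ℝ × E3)} {n : WithTop ℕ∞} (hf : ContDiffOn ℝ n f O) (t : ℝ) :
    ContDiffOn ℝ n (fun X => f (t, X)) {X | (t, X) ∈ O} :=
  hf.comp (contDiff_const.prodMk contDiff_id).contDiffOn fun _ hX => hX

theorem isOpen_slice {O : Set (ℝ × E3)} (hO : IsOpen O) (t : ℝ) : IsOpen {X | (t, X) ∈ O} :=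
  hO.preimage (by fun_prop)

theorem hasFDerivAt_jac {f : E3 → E3} {X : E3} (hf : ContDiffAt ℝ 2 f X) (i j : Fin 3) :
    HasFDerivAt (fun Y => jac f Y i j)
      (((EuclideanSpace.proj (𝕜 := ℝ) i : E3 →L[ℝ] ℝ).comp
        (ContinuousLinearMap.apply ℝ E3 (EuclideanSpace.single j (1 : ℝ) : E3))).comp
          (fderiv ℝ (fderiv ℝ f) X)) X := by
  have h1 : DifferentiableAt ℝ (fderiv ℝ f) X :=
    (hf.fderiv_right (m := 1) (by norm_num)).differentiableAt (by norm_num)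
  exact (((EuclideanSpace.proj (𝕜 := ℝ) i : E3 →L[ℝ] ℝ).comp
    (ContinuousLinearMap.apply ℝ E3 (EuclideanSpace.single j (1 : ℝ) : E3))).hasFDerivAt).comp X
      h1.hasFDerivAt

theorem pderiv_jac_comm {f : E3 → E3} {X : E3} (hf : ContDiffAt ℝ 2 f X) (i j l : Fin 3) :
    pderiv l (fun Y => jac f Y i j) X = pderiv j (fun Y => jac f Y i l) X := by
  unfold pderiv
  rw [(hasFDerivAt_jac hf i j).fderiv, (hasFDerivAt_jac hf i l).fderiv]
  have := (hf.isSymmSndFDerivAt (by simp)).eq (EuclideanSpace.single l 1)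
    (EuclideanSpace.single j 1)
  simp [this]

theorem contDiffOn_jac {f : E3 → E3} {U : Set E3} (hU : IsOpen U) (hf : ContDiffOn ℝ 2 f U)
    (i j : Fin 3) : ContDiffOn ℝ 1 (fun Y => jac f Y i j) U := by
  have h := hf.fderiv_of_isOpen hU (m := 1) (by norm_num)
  have h2 : ContDiffOn ℝ 1 (fun Y => fderiv ℝ f Y (EuclideanSpace.single j 1)) U :=
    h.clm_apply contDiffOn_const
  exact (contDiffOn_euclidean.1 h2) i

section Motion

variable {O : Set (ℝ × E3)} {χ : ℝ → E3 → E3}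

theorem defGrad_eq (hO : IsOpen O) (hχ : ContDiffOn ℝ 2 (Function.uncurry χ) O) {q : ℝ × E3}
    (hq : q ∈ O) (i j : Fin 3) : defGrad χ q.1 q.2 i j
      = fderiv ℝ (Function.uncurry χ) q (0, EuclideanSpace.single j 1) i := by
  have h := (hχ.contDiffAt (hO.mem_nhds hq)).differentiableAt (by norm_num)
  simp [defGrad, jac, (hasFDerivAt_slice (f := χ) (t := q.1) (X := q.2) h).fderiv]

theorem refVel_eq (hO : IsOpen O) (hχ : ContDiffOn ℝ 2 (Function.uncurry χ) O) {q : ℝ × E3}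
    (hq : q ∈ O) : refVel χ q.1 q.2 = fderiv ℝ (Function.uncurry χ) q (1, 0) := by
  have h := (hχ.contDiffAt (hO.mem_nhds hq)).differentiableAt (by norm_num)
  exact (hasDerivAt_slice (f := χ) (t := q.1) (X := q.2) h).deriv

theorem contDiffOn_defGrad (hO : IsOpen O) (hχ : ContDiffOn ℝ 2 (Function.uncurry χ) O)
    (i j : Fin 3) : ContDiffOn ℝ 1 (fun q : ℝ × E3 => defGrad χ q.1 q.2 i j) O := by
  have h := hχ.fderiv_of_isOpen hO (m := 1) (by norm_num)
  have h2 : ContDiffOn ℝ 1 (fun q => fderiv ℝ (Function.uncurry χ) q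
      (0, EuclideanSpace.single j 1)) O := h.clm_apply contDiffOn_const
  exact ((contDiffOn_euclidean.1 h2) i).congr fun q hq => defGrad_eq hO hχ hq i j

theorem contDiffOn_refVel (hO : IsOpen O) (hχ : ContDiffOn ℝ 2 (Function.uncurry χ) O) :
    ContDiffOn ℝ 1 (fun q : ℝ × E3 => refVel χ q.1 q.2) O := by
  have h := hχ.fderiv_of_isOpen hO (m := 1) (by norm_num)
  have h2 : ContDiffOn ℝ 1 (fun q => fderiv ℝ (Function.uncurry χ) q (1, 0)) O :=
    h.clm_apply contDiffOn_const
  exact h2.congr fun q hq => refVel_eq hO hχ hq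

/-- The time derivative of the deformation gradient is the gradient of the reference velocity,
because the mixed second derivatives of `χ` in time and space agree. -/
theorem hasDerivAt_defGrad (hO : IsOpen O) (hχ : ContDiffOn ℝ 2 (Function.uncurry χ) O) {t : ℝ}
    {X : E3} (hX : (t, X) ∈ O) (i j : Fin 3) :
    HasDerivAt (fun s => defGrad χ s X i j) (jac (refVel χ t) X i j) t := by
  have hc := hχ.contDiffAt (hO.mem_nhds hX)
  have h1 : DifferentiableAt ℝ (fderiv ℝ (Function.uncurry χ)) (t, X) :=
    (hc.fderiv_right (m := 1) (by norm_num)).differentiableAt (by norm_num)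
  have hs := (hc.isSymmSndFDerivAt (by simp)).eq
  set g' := fderiv ℝ (fderiv ℝ (Function.uncurry χ)) (t, X) with hg'
  have ht : HasDerivAt (fun s => fderiv ℝ (Function.uncurry χ) (s, X)) (g' (1, 0)) t :=
    h1.hasFDerivAt.comp_hasDerivAt t ((hasDerivAt_id t).prodMk (hasDerivAt_const t X))
  have hx : HasFDerivAt (fun Y => fderiv ℝ (Function.uncurry χ) (t, Y))
      (g'.comp (ContinuousLinearMap.inr ℝ ℝ E3)) X :=
    h1.hasFDerivAt.comp X (hasFDerivAt_prodMk_right t X)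
  have hx2 : HasFDerivAt (refVel χ t) ((ContinuousLinearMap.apply ℝ E3 ((1 : ℝ), (0 : E3))).comp
      (g'.comp (ContinuousLinearMap.inr ℝ ℝ E3))) X := by
    refine ((ContinuousLinearMap.apply ℝ E3 ((1 : ℝ), (0 : E3))).hasFDerivAt.comp X
      hx).congr_of_eventuallyEq ?_
    filter_upwards [(isOpen_slice hO t).mem_nhds hX] with Y hY
    exact refVel_eq hO hχ (q := (t, Y)) hY
  have hval : jac (refVel χ t) X i j = g' (1, 0) (0, EuclideanSpace.single j 1) i := by
    simp only [jac, of_apply, hx2.fderiv]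
    simp [hs (1, 0) (0, EuclideanSpace.single j 1)]
  rw [hval]
  have h3 := ((EuclideanSpace.proj (𝕜 := ℝ) i : E3 →L[ℝ] ℝ).comp
    (ContinuousLinearMap.apply ℝ E3
      ((0 : ℝ), (EuclideanSpace.single j (1 : ℝ) : E3)))).hasFDerivAt.comp_hasDerivAt t ht
  refine h3.congr_of_eventuallyEq ?_
  have hev : ∀ᶠ s in 𝓝 t, (s, X) ∈ O :=
    (hO.preimage (by fun_prop : Continuous fun s : ℝ => (s, X))).mem_nhds hX
  filter_upwards [hev] with s hs'
  exact defGrad_eq hO hχ (q := (s, X)) hs' i j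

theorem contDiffOn_det {E : Type*} [NormedAddCommGroup E] [NormedSpace ℝ E]
    {A : E → Matrix (Fin 3) (Fin 3) ℝ} {U : Set E}
    (h : ∀ i j, ContDiffOn ℝ 1 (fun q => A q i j) U) : ContDiffOn ℝ 1 (fun q => (A q).det) U := by
  simp only [det_fin_three]
  fun_prop

theorem contDiffOn_adjugate {E : Type*} [NormedAddCommGroup E] [NormedSpace ℝ E]
    {A : E → Matrix (Fin 3) (Fin 3) ℝ} {U : Set E}
    (h : ∀ i j, ContDiffOn ℝ 1 (fun q => A q i j) U) (i j : Fin 3) :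
    ContDiffOn ℝ 1 (fun q => (A q).adjugate i j) U := by
  simp only [adjugate_apply_fin_three]
  fun_prop

theorem contDiffOn_matrix_mul {E : Type*} [NormedAddCommGroup E] [NormedSpace ℝ E]
    {A B : E → Matrix (Fin 3) (Fin 3) ℝ} {U : Set E}
    (hA : ∀ i j, ContDiffOn ℝ 1 (fun q => A q i j) U)
    (hB : ∀ i j, ContDiffOn ℝ 1 (fun q => B q i j) U) (i j : Fin 3) :
    ContDiffOn ℝ 1 (fun q => (A q * B q) i j) U := by
  simp only [mul_apply]
  fun_prop

theorem contDiffOn_inv {E : Type*} [NormedAddCommGroup E] [NormedSpace ℝ E]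
    {A : E → Matrix (Fin 3) (Fin 3) ℝ} {U : Set E}
    (h : ∀ i j, ContDiffOn ℝ 1 (fun q => A q i j) U) (h0 : ∀ q ∈ U, (A q).det ≠ 0) (i j : Fin 3) :
    ContDiffOn ℝ 1 (fun q => (A q)⁻¹ i j) U := by
  simp only [inv_def, Matrix.smul_apply, Ring.inverse_eq_inv', smul_eq_mul]
  exact ((contDiffOn_det h).inv h0).mul (contDiffOn_adjugate h i j)

/-- The part of the time slice of `O` where the reference map is orientation preserving. -/
def posSlice (O : Set (ℝ × E3)) (χ : ℝ → E3 → E3) (t : ℝ) : Set E3 :=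
  {X | (t, X) ∈ O} ∩ (fun X => (defGrad χ t X).det) ⁻¹' Ioi 0

theorem contDiffOn_defGrad_slice (hO : IsOpen O) (hχ : ContDiffOn ℝ 2 (Function.uncurry χ) O)
    (t : ℝ) (i j : Fin 3) : ContDiffOn ℝ 1 (fun X => defGrad χ t X i j) {X | (t, X) ∈ O} :=
  contDiffOn_slice (contDiffOn_defGrad hO hχ i j) t

theorem isOpen_posSlice (hO : IsOpen O) (hχ : ContDiffOn ℝ 2 (Function.uncurry χ) O) (t : ℝ) :
    IsOpen (posSlice O χ t) :=
  (contDiffOn_det (contDiffOn_defGrad_slice hO hχ t)).continuousOn.isOpen_inter_preimage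
    (isOpen_slice hO t) isOpen_Ioi

theorem contDiffOn_spatialGrad (hO : IsOpen O) (hχ : ContDiffOn ℝ 2 (Function.uncurry χ) O)
    {v : ℝ → E3 → E3} {t : ℝ} (hv : ContDiffOn ℝ 2 (v t) {X | (t, X) ∈ O}) (i j : Fin 3) :
    ContDiffOn ℝ 1 (fun X => spatialGrad χ v t X i j) (posSlice O χ t) := by
  refine contDiffOn_matrix_mul (fun i j => ?_) (contDiffOn_inv (fun i j => ?_) ?_) i j
  · exact (contDiffOn_jac (isOpen_slice hO t) hv i j).mono inter_subset_left
  · exact (contDiffOn_defGrad_slice hO hχ t i j).mono inter_subset_left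
  · intro X hX
    exact ne_of_gt hX.2

theorem contDiffOn_piola (hO : IsOpen O) (hχ : ContDiffOn ℝ 2 (Function.uncurry χ) O)
    {v : ℝ → E3 → E3} {p : ℝ → E3 → ℝ} {t μ : ℝ} (hv : ContDiffOn ℝ 2 (v t) {X | (t, X) ∈ O})
    (hp : ContDiffOn ℝ 1 (p t) {X | (t, X) ∈ O}) (i j : Fin 3) :
    ContDiffOn ℝ 1 (fun X => piola μ χ v p t X i j) (posSlice O χ t) := by
  have hF : ∀ i j, ContDiffOn ℝ 1 (fun X => defGrad χ t X i j) (posSlice O χ t) := fun i j =>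
    (contDiffOn_defGrad_slice hO hχ t i j).mono inter_subset_left
  have hL := contDiffOn_spatialGrad hO hχ hv
  have hp' : ContDiffOn ℝ 1 (p t) (posSlice O χ t) := hp.mono inter_subset_left
  have hS : ∀ i j, ContDiffOn ℝ 1 (fun X => stress μ χ v p t X i j) (posSlice O χ t) := by
    intro i j
    simp only [stress, Matrix.add_apply, Matrix.smul_apply, transpose_apply, smul_eq_mul]
    exact (hp'.neg.mul contDiffOn_const).add (contDiffOn_const.mul ((hL i j).add (hL j i)))
  simp only [piola, Matrix.smul_apply, smul_eq_mul]
  refine (contDiffOn_det hF).mul (contDiffOn_matrix_mul hS (fun i j => ?_) i j)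
  simp only [transpose_apply]
  exact contDiffOn_inv hF (fun X hX => ne_of_gt hX.2) j i

end Motion

/-! ### Local energy balance -/

/-- The flux in the energy balance: power of the traction, minus the transport of kinetic energy
relative to the reference. -/
def energyFlux (ρ μ : ℝ) (χ v : ℝ → E3 → E3) (p : ℝ → E3 → ℝ) (t : ℝ) (X : E3) : E3 :=
  WithLp.toLp 2 fun j => (∑ i, piola μ χ v p t X i j * v t X i)
    - (ρ / 2 * ‖v t X‖ ^ 2) * ∑ k, (defGrad χ t X).adjugate j k * (v t X - refVel χ t X) k

/-- The density `J (L + Lᵀ) : L` of the viscous dissipation per unit viscosity. -/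
def dissipation (χ v : ℝ → E3 → E3) (t : ℝ) (X : E3) : ℝ :=
  (defGrad χ t X).det * frob (spatialGrad χ v t X + (spatialGrad χ v t X)ᵀ) (spatialGrad χ v t X)

/-- Twice the kinetic energy per unit mass and referential volume. -/
def energyDensity (χ v : ℝ → E3 → E3) (t : ℝ) (X : E3) : ℝ :=
  (defGrad χ t X).det * ‖v t X‖ ^ 2

section Solution

variable {O : Set (ℝ × E3)} {χ v : ℝ → E3 → E3} {p : ℝ → E3 → ℝ} {t μ ρ : ℝ}

theorem contDiffOn_energyFlux (hO : IsOpen O) (hχ : ContDiffOn ℝ 2 (Function.uncurry χ) O)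
    (hv : ContDiffOn ℝ 2 (v t) {X | (t, X) ∈ O}) (hp : ContDiffOn ℝ 1 (p t) {X | (t, X) ∈ O}) :
    ContDiffOn ℝ 1 (energyFlux ρ μ χ v p t) (posSlice O χ t) := by
  have hv1 : ContDiffOn ℝ 1 (v t) (posSlice O χ t) :=
    (hv.of_le (by norm_num)).mono inter_subset_left
  have hw : ContDiffOn ℝ 1 (refVel χ t) (posSlice O χ t) :=
    (contDiffOn_slice (contDiffOn_refVel hO hχ) t).mono inter_subset_left
  have hA : ∀ j k, ContDiffOn ℝ 1 (fun X => (defGrad χ t X).adjugate j k) (posSlice O χ t) :=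
    contDiffOn_adjugate fun i j => (contDiffOn_defGrad_slice hO hχ t i j).mono inter_subset_left
  have hP := contDiffOn_piola (μ := μ) hO hχ hv hp
  rw [contDiffOn_euclidean]
  intro j
  simp only [energyFlux]
  refine (ContDiffOn.sum fun i _ => (hP i j).mul ((contDiffOn_euclidean.1 hv1) i)).sub
    ((contDiffOn_const.mul (hv1.norm_sq ℝ)).mul (ContDiffOn.sum fun k _ => (hA j k).mul
      ((contDiffOn_euclidean.1 (hv1.sub hw)) k)))

theorem contDiffOn_energyDensity (hO : IsOpen O) (hχ : ContDiffOn ℝ 2 (Function.uncurry χ) O)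
    (hv : ContDiffOn ℝ 1 (Function.uncurry v) O) :
    ContDiffOn ℝ 1 (Function.uncurry (energyDensity χ v)) O :=
  (contDiffOn_det (contDiffOn_defGrad hO hχ)).mul (hv.norm_sq ℝ)

/-- The local energy balance. -/
theorem hasDerivAt_energyDensity (hρ : ρ ≠ 0) (hO : IsOpen O)
    (hχ : ContDiffOn ℝ 2 (Function.uncurry χ) O) (hv : ContDiffOn ℝ 1 (Function.uncurry v) O)
    (hvt : ContDiffOn ℝ 2 (v t) {X | (t, X) ∈ O}) (hp : ContDiffOn ℝ 1 (p t) {X | (t, X) ∈ O})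
    {X : E3} (hX : X ∈ posSlice O χ t) (hm : MomentumBalance ρ μ (fun _ _ => 0) χ v p t X)
    (hi : Incompressible χ v t X) :
    HasDerivAt (fun s => energyDensity χ v s X)
      (2 / ρ * (divergence (energyFlux ρ μ χ v p t) X - μ * dissipation χ v t X)) t := by
  have hDo := (isOpen_posSlice hO hχ t).mem_nhds hX
  have hdet : (defGrad χ t X).det ≠ 0 := ne_of_gt hX.2
  have hPd : ∀ i j, DifferentiableAt ℝ (fun Y => piola μ χ v p t Y i j) X := fun i j =>
    ((contDiffOn_piola hO hχ hvt hp i j).contDiffAt hDo).differentiableAt (by norm_num)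
  have hFd : ∀ i j, DifferentiableAt ℝ (fun Y => defGrad χ t Y i j) X := fun i j =>
    ((contDiffOn_defGrad_slice hO hχ t i j).contDiffAt
      ((isOpen_slice hO t).mem_nhds hX.1)).differentiableAt (by norm_num)
  have hAd : ∀ j k, DifferentiableAt ℝ (fun Y => (defGrad χ t Y).adjugate j k) X := fun j k =>
    ((contDiffOn_adjugate (contDiffOn_defGrad_slice hO hχ t) j k).contDiffAt
      ((isOpen_slice hO t).mem_nhds hX.1)).differentiableAt (by norm_num)
  have hvd : DifferentiableAt ℝ (v t) X :=
    (hvt.contDiffAt ((isOpen_slice hO t).mem_nhds hX.1)).differentiableAt (by norm_num)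
  have hwd : DifferentiableAt ℝ (refVel χ t) X :=
    ((contDiffOn_slice (contDiffOn_refVel hO hχ) t).contDiffAt
      ((isOpen_slice hO t).mem_nhds hX.1)).differentiableAt (by norm_num)
  have hqd : DifferentiableAt ℝ (fun Y => ρ / 2 * ‖v t Y‖ ^ 2) X :=
    (hvd.norm_sq ℝ).const_mul _
  have hχt : ContDiffAt ℝ 2 (χ t) X :=
    (contDiffOn_slice hχ t).contDiffAt ((isOpen_slice hO t).mem_nhds hX.1)
  have hdiv := divergence_flux (P := piola μ χ v p t) (A := fun Y => (defGrad χ t Y).adjugate)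
    (a := v t) (c := fun Y => v t Y - refVel χ t Y) hPd hAd hvd (hvd.sub hwd) hqd
    (sum_pderiv_adjugate hFd fun i j l => pderiv_jac_comm hχt i j l)
  have hvs : HasDerivAt (fun s => v s X) (deriv (fun s => v s X) t) t :=
    (hasDerivAt_slice ((hv.contDiffAt (hO.mem_nhds hX.1)).differentiableAt
      (by norm_num))).differentiableAt.hasDerivAt
  have hJ := hasDerivAt_det (F := fun s => defGrad χ s X) (hasDerivAt_defGrad hO hχ hX.1)
  refine (hJ.mul hvs.norm_sq).congr_deriv ?_
  have hdq : ∀ j, pderiv j (fun Y => ρ / 2 * ‖v t Y‖ ^ 2) X = ρ * ∑ i, v t X i * jac (v t) X i j := by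
    intro j
    have h1 := (hvd.hasFDerivAt.norm_sq).const_mul (ρ / 2)
    have h3 : fderiv ℝ (fun Y => ρ / 2 * ‖v t Y‖ ^ 2) X = _ := h1.fderiv
    rw [pderiv, h3]
    simp [jac, PiLp.inner_apply, mul_comm]
    ring
  have hjc : ∀ k j, jac (fun Y => v t Y - refVel χ t Y) X k j
      = jac (v t) X k j - jac (refVel χ t) X k j := by
    intro k j
    simp only [jac, of_apply]
    rw [fderiv_fun_sub hvd hwd]
    simp
  have hpow : frob (piola μ χ v p t X) (jac (v t) X) = μ * dissipation χ v t X := by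
    have htr : (spatialGrad χ v t X).trace = 0 := by
      rw [spatialGrad, trace_mul_eq_frob]; exact hi
    rw [piola, stress_power]
    change _ * frob _ (spatialGrad χ v t X) = _
    rw [stress, frob_newtonian htr, dissipation]
    ring
  change _ = 2 / ρ * (divergence (fun Y => WithLp.toLp 2 fun j => _) X - _)
  rw [hdiv, hpow]
  simp only [hdq, hjc]
  have hm' : ∀ i, rowDiv (piola μ χ v p t) X i = ρ * (deriv (fun s => v s X) t i
      + (spatialGrad χ v t X *ᵥ ⇑(v t X - refVel χ t X)) i) * (defGrad χ t X).det := by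
    intro i
    rw [hm i]; simp
  simp only [hm']
  have hi' : ∑ j, ∑ k, (defGrad χ t X).adjugate j k * jac (v t) X k j = 0 := by
    have : frob (jac (v t) X) ((defGrad χ t X)⁻¹)ᵀ = 0 := hi
    simp only [frob, transpose_apply] at this
    simp only [adjugate_eq_det_mul_inv hdet]
    rw [Finset.sum_comm]
    calc _ = (defGrad χ t X).det * ∑ i, ∑ j, jac (v t) X i j * (defGrad χ t X)⁻¹ j i := by
          simp only [Finset.mul_sum]
          exact Finset.sum_congr rfl fun i _ => Finset.sum_congr rfl fun j _ => by ring
      _ = 0 := by rw [this, mul_zero]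
  have hin : inner ℝ (v t X) (deriv (fun s => v s X) t)
      = ∑ i, v t X i * deriv (fun s => v s X) t i := by
    simp [PiLp.inner_apply, mul_comm]
  rw [hin]
  -- Since the adjugate is `J F⁻¹`, the transport of kinetic energy in the flux cancels the
  -- convective term of the momentum balance.
  have hconv : ∑ j, (ρ * ∑ i, v t X i * jac (v t) X i j) *
        ∑ k, (defGrad χ t X).adjugate j k * (v t X - refVel χ t X) k
      = ∑ i, ρ * (spatialGrad χ v t X *ᵥ ⇑(v t X - refVel χ t X)) i * (defGrad χ t X).det
        * v t X i := by
    simp only [adjugate_eq_det_mul_inv hdet, spatialGrad, mulVec, dotProduct, mul_apply,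
      Fin.sum_univ_three]
    ring
  -- Incompressibility removes the part from `v`; what is left is `-∂J/∂t`, which supplies the term
  -- `|v|² ∂J/∂t` of the time derivative.
  have hsplit : ∑ j, ∑ k, (defGrad χ t X).adjugate j k *
        (jac (v t) X k j - jac (refVel χ t) X k j)
      = - ∑ j, ∑ k, (defGrad χ t X).adjugate j k * jac (refVel χ t) X k j := by
    simp only [mul_sub, Finset.sum_sub_distrib, hi', zero_sub]
  rw [hconv, hsplit]
  have hmom : ∑ i, ρ * (deriv (fun s => v s X) t i
      + (spatialGrad χ v t X *ᵥ ⇑(v t X - refVel χ t X)) i) * (defGrad χ t X).det * v t X i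
      = ρ * (defGrad χ t X).det * (∑ i, v t X i * deriv (fun s => v s X) t i)
        + ∑ i, ρ * (spatialGrad χ v t X *ᵥ ⇑(v t X - refVel χ t X)) i * (defGrad χ t X).det
          * v t X i := by
    rw [Finset.mul_sum, ← Finset.sum_add_distrib]
    exact Finset.sum_congr rfl fun i _ => by ring
  rw [hmom]
  field_simp
  ring

end Solution

/-! ### Boundary behaviour of the energy flux -/

section Boundary

theorem eq_zero_of_mem_frontier {Ω U : Set E3} {φ : E3 → ℝ} (hΩ : IsOpen Ω) (hU : IsOpen U)
    (hφ : ContinuousOn φ U) (hΩU : Ω ∩ U = {Y | Y ∈ U ∧ φ Y < 0}) {Y : E3} (hY : Y ∈ U)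
    (hYf : Y ∈ frontier Ω) : φ Y = 0 := by
  rw [hΩ.frontier_eq] at hYf
  refine le_antisymm ?_ ?_
  · by_contra hpos
    have hev : ∀ᶠ Z in 𝓝 Y, Z ∈ U ∧ 0 < φ Z :=
      (show ∀ᶠ Z in 𝓝 Y, Z ∈ U from hU.mem_nhds hY).and ((hφ.continuousAt (hU.mem_nhds hY)).eventually_const_lt (not_le.1 hpos))
    obtain ⟨Z, ⟨hZU, hZ⟩, hZΩ⟩ := mem_closure_iff_nhds.1 hYf.1 _ hev
    have := (Set.ext_iff.1 hΩU Z).1 ⟨hZΩ, hZU⟩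
    exact lt_asymm hZ this.2
  · by_contra hneg
    exact hYf.2 ((Set.ext_iff.1 hΩU Y).2 ⟨hY, not_le.1 hneg⟩).1

variable {Ω : Set E3} {χ v : ℝ → E3 → E3} {p : ℝ → E3 → ℝ} {t μ ρ : ℝ} {X N : E3}

theorem energyFlux_eq_zero (h : v t X = 0) : energyFlux ρ μ χ v p t X = 0 := by
  ext j
  simp [energyFlux, h]

/-- This separates the power of the traction from the transport across the boundary. On the free
part the traction and the relative velocity vanish; on the wall the traction is normal while both
velocities are tangential. -/
theorem inner_energyFlux (hdet : (defGrad χ t X).det ≠ 0) :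
    inner ℝ N (energyFlux ρ μ χ v p t X) = (piola μ χ v p t X *ᵥ ⇑N) ⬝ᵥ ⇑(v t X)
      - ρ / 2 * ‖v t X‖ ^ 2 * (defGrad χ t X).det
        * (spatialNormal χ t X N ⬝ᵥ ⇑(v t X - refVel χ t X)) := by
  simp only [energyFlux, PiLp.inner_apply, spatialNormal, adjugate_eq_det_mul_inv hdet, mulVec,
    dotProduct, transpose_apply, Fin.sum_univ_three]
  simp
  ring

theorem inner_energyFlux_of_free (hdet : (defGrad χ t X).det ≠ 0)
    (h : IsLagrangianFree μ Ω χ v p t X) (hN : IsOutwardUnitNormal Ω X N) :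
    inner ℝ N (energyFlux ρ μ χ v p t X) = 0 := by
  rw [inner_energyFlux hdet, h.2.2 N hN, h.1]
  simp

theorem inner_energyFlux_of_wall (hdet : (defGrad χ t X).det ≠ 0)
    (h : IsFixedImpermeable μ Ω χ v p t X) (hN : IsOutwardUnitNormal Ω X N) :
    inner ℝ N (energyFlux ρ μ χ v p t X) = 0 := by
  obtain ⟨h1, h2, a, ha⟩ := h.2 N hN
  rw [inner_energyFlux hdet, ha, smul_dotProduct, h1, WithLp.ofLp_sub, dotProduct_sub, h1, h2]
  simp

/-- The function `φ` that defines the surface at `X` also gives the normals at nearby boundary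
points, once `U` is shrunk to where its gradient is nonzero. Such points may belong to another part
of the boundary, so `h` covers the whole frontier. -/
theorem isTangentialAt_energyFlux (hΩ : IsOpen Ω) (hN : IsOutwardUnitNormal Ω X N)
    (h : ∀ Y ∈ frontier Ω, ∀ M, IsOutwardUnitNormal Ω Y M →
      inner ℝ M (energyFlux ρ μ χ v p t Y) = 0) :
    IsTangentialAt Ω (energyFlux ρ μ χ v p t) X := by
  obtain ⟨U, φ, hU, hX, hφ, -, hg, hΩU, -⟩ := hN
  have hiff : ∀ Y, gradient φ Y ≠ 0 ↔ fderiv ℝ φ Y ≠ 0 := fun Y => by simp [gradient]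
  have hc := hφ.continuousOn_fderiv_of_isOpen hU (by norm_num)
  refine ⟨U ∩ fderiv ℝ φ ⁻¹' {0}ᶜ, φ, hc.isOpen_inter_preimage hU isOpen_compl_singleton,
    ⟨hX, (hiff X).1 hg⟩, hφ.mono inter_subset_left, (hiff X).1 hg, ?_, fun Y hY hYf => ?_⟩
  · ext Y
    have := Set.ext_iff.1 hΩU Y
    simp only [mem_inter_iff, mem_ofPred_eq] at this ⊢
    tauto
  · have hg' : gradient φ Y ≠ 0 := (hiff Y).2 hY.2
    have h0 := h Y hYf (‖gradient φ Y‖⁻¹ • gradient φ Y) ⟨U, φ, hU, hY.1, hφ,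
      eq_zero_of_mem_frontier hΩ hU hφ.continuousOn hΩU hY.1 hYf, hg', hΩU, rfl⟩
    rw [real_inner_smul_left] at h0
    have h1 : inner ℝ (gradient φ Y) (energyFlux ρ μ χ v p t Y) = 0 :=
      (mul_eq_zero.1 h0).resolve_left (by simpa using hg')
    rwa [gradient, InnerProductSpace.toDual_symm_apply] at h1

theorem energyFlux_boundary {Γfree Γwall Γfix : Set E3} (hΩ : IsOpen Ω)
    (hdet : ∀ Y ∈ closure Ω, (defGrad χ t Y).det ≠ 0)
    (hΓ : frontier Ω = Γfree ∪ Γwall ∪ Γfix)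
    (hfree : ∀ Y ∈ Γfree, IsLagrangianFree μ Ω χ v p t Y)
    (hwall : ∀ Y ∈ Γwall, IsFixedImpermeable μ Ω χ v p t Y)
    (hfix : ∀ Y ∈ Γfix, v t Y = 0) (hX : X ∈ frontier Ω) :
    energyFlux ρ μ χ v p t X = 0 ∨ IsTangentialAt Ω (energyFlux ρ μ χ v p t) X := by
  have hall : ∀ Y ∈ frontier Ω, ∀ M, IsOutwardUnitNormal Ω Y M →
      inner ℝ M (energyFlux ρ μ χ v p t Y) = 0 := by
    intro Y hY M hM
    have hd := hdet Y (frontier_subset_closure hY)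
    rw [hΓ] at hY
    rcases hY with (hY | hY) | hY
    · exact inner_energyFlux_of_free hd (hfree Y hY) hM
    · exact inner_energyFlux_of_wall hd (hwall Y hY) hM
    · rw [energyFlux_eq_zero (hfix Y hY), inner_zero_right]
  rw [hΓ] at hX
  rcases hX with (hX | hX) | hX
  · obtain ⟨N, hN⟩ := (hfree X hX).2.1
    exact Or.inr (isTangentialAt_energyFlux hΩ hN hall)
  · obtain ⟨N, hN⟩ := (hwall X hX).1
    exact Or.inr (isTangentialAt_energyFlux hΩ hN hall)
  · exact Or.inl (energyFlux_eq_zero (hfix X hX))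

end Boundary

/-! ### Differentiation under the integral and global energy balance -/

theorem integrableOn_of_continuousOn_closure {Ω : Set E3} (hb : Bornology.IsBounded Ω)
    {f : E3 → ℝ} (hf : ContinuousOn f (closure Ω)) : IntegrableOn f Ω :=
  (hf.integrableOn_compact hb.isCompact_closure).mono_set subset_closure

/-- Differentiation under the integral sign for a density that is `C¹` up to the boundary. -/
theorem hasDerivAt_setIntegral {Ω : Set E3} {O : Set (ℝ × E3)} {e : ℝ → E3 → ℝ} {t : ℝ}
    (hΩ : IsOpen Ω) (hb : Bornology.IsBounded Ω) (hO : IsOpen O)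
    (he : ContDiffOn ℝ 1 (Function.uncurry e) O) (hsub : ∀ X ∈ closure Ω, (t, X) ∈ O) :
    HasDerivAt (fun s => ∫ X in Ω, e s X) (∫ X in Ω, deriv (fun s => e s X) t) t := by
  have hK : IsCompact (closure Ω) := hb.isCompact_closure
  -- The tube lemma gives a two-sided time interval about `t` on which the density and its
  -- derivative are controlled on all of `closure Ω`.
  obtain ⟨I, V, hI, -, htI, hV, hIV⟩ := generalized_tube_lemma (isCompact_singleton (x := t)) hK hO
    (by rintro ⟨s, X⟩ ⟨hs, hX⟩; obtain rfl : s = t := hs; exact hsub X hX)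
  obtain ⟨ε, hε, hball⟩ := Metric.nhds_basis_closedBall.mem_iff.1
    (hI.mem_nhds (htI (mem_singleton t)))
  have hKO : Metric.closedBall t ε ×ˢ closure Ω ⊆ O := (prod_mono hball hV).trans hIV
  have hdc : ContinuousOn (fun q => fderiv ℝ (Function.uncurry e) q (1, 0)) O :=
    (he.continuousOn_fderiv_of_isOpen hO (by norm_num)).clm_apply continuousOn_const
  obtain ⟨M, hM⟩ := ((isCompact_closedBall t ε).prod hK).exists_bound_of_continuousOn
    (hdc.mono hKO)
  have hder : ∀ s ∈ Metric.closedBall t ε, ∀ X ∈ Ω,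
      HasDerivAt (fun s => e s X) (fderiv ℝ (Function.uncurry e) (s, X) (1, 0)) s :=
    fun s hs X hX => hasDerivAt_slice ((he.contDiffAt (hO.mem_nhds
      (hKO ⟨hs, subset_closure hX⟩))).differentiableAt (by norm_num))
  have hcont : ∀ s ∈ Metric.closedBall t ε, ContinuousOn (e s) (closure Ω) := fun s hs =>
    he.continuousOn.comp (f := fun X => (s, X)) (by fun_prop) fun X hX => hKO ⟨hs, hX⟩
  have hdert : ∀ X ∈ Ω, deriv (fun s => e s X) t
      = fderiv ℝ (Function.uncurry e) (t, X) (1, 0) := fun X hX =>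
    (hder t (Metric.mem_closedBall_self hε.le) X hX).deriv
  rw [setIntegral_congr_fun hΩ.measurableSet hdert]
  have hfin : volume Ω ≠ ⊤ := hb.measure_lt_top.ne
  refine (hasDerivAt_integral_of_dominated_loc_of_deriv_le (μ := volume.restrict Ω)
    (s := Metric.closedBall t ε) (bound := fun _ => M)
    (F' := fun s X => fderiv ℝ (Function.uncurry e) (s, X) (1, 0))
    (Metric.closedBall_mem_nhds t hε) ?_ ?_ ?_ ?_ ?_ ?_).2
  · filter_upwards [Metric.closedBall_mem_nhds t hε] with s hs
    exact (integrableOn_of_continuousOn_closure hb (hcont s hs)).aestronglyMeasurable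
  · exact integrableOn_of_continuousOn_closure hb (hcont t (Metric.mem_closedBall_self hε.le))
  · refine (integrableOn_of_continuousOn_closure hb ?_).aestronglyMeasurable
    exact hdc.comp (f := fun X => (t, X)) (by fun_prop)
      fun X hX => hKO ⟨Metric.mem_closedBall_self hε.le, hX⟩
  · rw [ae_restrict_iff' hΩ.measurableSet]
    exact Eventually.of_forall fun X hX s hs => hM (s, X) ⟨hs, subset_closure hX⟩
  · exact integrableOn_const hfin
  · rw [ae_restrict_iff' hΩ.measurableSet]
    exact Eventually.of_forall fun X hX s hs => hder s hs X hX

section Balance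

variable {O : Set (ℝ × E3)} {Ω : Set E3} {χ v : ℝ → E3 → E3} {p : ℝ → E3 → ℝ} {t μ ρ : ℝ}

theorem continuousOn_dissipation (hO : IsOpen O) (hχ : ContDiffOn ℝ 2 (Function.uncurry χ) O)
    (hvt : ContDiffOn ℝ 2 (v t) {X | (t, X) ∈ O}) :
    ContinuousOn (dissipation χ v t) (posSlice O χ t) := by
  have hL := fun i j => (contDiffOn_spatialGrad hO hχ hvt i j).continuousOn
  have hd : ContinuousOn (fun X => (defGrad χ t X).det) (posSlice O χ t) :=
    (contDiffOn_det fun i j => (contDiffOn_defGrad_slice hO hχ t i j).mono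
      inter_subset_left).continuousOn
  unfold dissipation frob
  simp only [Matrix.add_apply, transpose_apply]
  fun_prop

/-- The energy balance: kinetic energy is lost to viscous dissipation only. -/
theorem hasDerivAt_energy (hρ : ρ ≠ 0) (hΩ : IsOpen Ω) (hb : Bornology.IsBounded Ω) (hO : IsOpen O)
    (hχ : ContDiffOn ℝ 2 (Function.uncurry χ) O) (hv : ContDiffOn ℝ 1 (Function.uncurry v) O)
    (hvt : ContDiffOn ℝ 2 (v t) {X | (t, X) ∈ O}) (hp : ContDiffOn ℝ 1 (p t) {X | (t, X) ∈ O})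
    (hsub : closure Ω ⊆ posSlice O χ t)
    (hm : ∀ X ∈ Ω, MomentumBalance ρ μ (fun _ _ => 0) χ v p t X)
    (hi : ∀ X ∈ Ω, Incompressible χ v t X)
    (hbd : ∀ X ∈ frontier Ω, energyFlux ρ μ χ v p t X = 0
      ∨ IsTangentialAt Ω (energyFlux ρ μ χ v p t) X) :
    HasDerivAt (fun s => ∫ X in Ω, energyDensity χ v s X)
      (-2 * (μ / ρ) * ∫ X in Ω, dissipation χ v t X) t := by
  refine (hasDerivAt_setIntegral hΩ hb hO (contDiffOn_energyDensity hO hχ hv)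
    fun X hX => (hsub hX).1).congr_deriv ?_
  have hpt : ∀ X ∈ Ω, deriv (fun s => energyDensity χ v s X) t
      = 2 / ρ * (divergence (energyFlux ρ μ χ v p t) X - μ * dissipation χ v t X) := fun X hX =>
    (hasDerivAt_energyDensity hρ hO hχ hv hvt hp (hsub (subset_closure hX)) (hm X hX)
      (hi X hX)).deriv
  obtain ⟨hdi, hd0⟩ := setIntegral_divergence_eq_zero hΩ hb (isOpen_posSlice hO hχ t) hsub
    (contDiffOn_energyFlux hO hχ hvt hp) hbd
  have hDi : IntegrableOn (dissipation χ v t) Ω := integrableOn_of_continuousOn_closure hb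
    ((continuousOn_dissipation hO hχ hvt).mono hsub)
  rw [setIntegral_congr_fun hΩ.measurableSet hpt, integral_const_mul,
    integral_sub hdi (hDi.const_mul μ), hd0, integral_const_mul]
  ring

end Balance

/-! ### Matrices as operators, and the strain norm -/

theorem fderiv_eq_toEuclideanCLM (f : E3 → E3) (X : E3) :
    fderiv ℝ f X = toEuclideanCLM (𝕜 := ℝ) (jac f X) := by
  ext a i
  rw [ofLp_toEuclideanCLM, jac_mulVec]

theorem det_toEuclideanCLM (A : Matrix (Fin 3) (Fin 3) ℝ) :
    (toEuclideanCLM (𝕜 := ℝ) A : E3 →L[ℝ] E3).det = A.det := by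
  rw [ContinuousLinearMap.det, coe_toEuclideanCLM_eq_toEuclideanLin]
  change LinearMap.det (toLpLin 2 2 A) = _
  rw [toLpLin_eq_toLin, LinearMap.det_toLin]

/-- An invertible matrix as an automorphism of Euclidean space. -/
def equivOfDetNeZero (A : Matrix (Fin 3) (Fin 3) ℝ) (h : A.det ≠ 0) : E3 ≃L[ℝ] E3 :=
  ContinuousLinearEquiv.equivOfInverse (toEuclideanCLM (𝕜 := ℝ) A)
    (toEuclideanCLM (𝕜 := ℝ) A⁻¹)
    (fun x => by
      rw [← mul_apply_eq_comp, ← map_mul, nonsing_inv_mul _ (isUnit_iff_ne_zero.2 h)]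
      simp)
    (fun x => by
      rw [← mul_apply_eq_comp, ← map_mul, mul_nonsing_inv _ (isUnit_iff_ne_zero.2 h)]
      simp)

theorem frob_self_nonneg (S : Matrix (Fin 3) (Fin 3) ℝ) : 0 ≤ frob S S :=
  Finset.sum_nonneg fun _ _ => Finset.sum_nonneg fun _ _ => mul_self_nonneg _

theorem frob_symm_self (L : Matrix (Fin 3) (Fin 3) ℝ) :
    frob (L + Lᵀ) (L + Lᵀ) = 2 * frob (L + Lᵀ) L := by
  simp [frob, Fin.sum_univ_three]
  ring

/-- The Frobenius norm of the symmetric part of a velocity gradient. -/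
def strainNorm (L : Matrix (Fin 3) (Fin 3) ℝ) : ℝ := 1 / 2 * √(frob (L + Lᵀ) (L + Lᵀ))

theorem strainNorm_nonneg (L : Matrix (Fin 3) (Fin 3) ℝ) : 0 ≤ strainNorm L := by
  unfold strainNorm; positivity

theorem strainNorm_sq (L : Matrix (Fin 3) (Fin 3) ℝ) :
    strainNorm L ^ 2 = 1 / 2 * frob (L + Lᵀ) L := by
  rw [strainNorm, mul_pow, Real.sq_sqrt (frob_self_nonneg _), frob_symm_self]
  ring

theorem continuous_strainNorm : Continuous strainNorm := by
  unfold strainNorm frob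
  simp only [Matrix.add_apply, transpose_apply]
  fun_prop

/-- The quadratic form depends only on the symmetric part; then Cauchy-Schwarz over index pairs,
with `∑ (aᵢ aⱼ)² = ‖a‖⁴`. -/
theorem abs_inner_le_strainNorm (L : Matrix (Fin 3) (Fin 3) ℝ) (a : E3) :
    |inner ℝ (toEuclideanCLM (𝕜 := ℝ) L a) a| ≤ strainNorm L * ‖a‖ ^ 2 := by
  set S := L + Lᵀ with hS
  have h1 : inner ℝ (toEuclideanCLM (𝕜 := ℝ) L a) a
      = 1 / 2 * ∑ q : Fin 3 × Fin 3, S q.1 q.2 * (a q.1 * a q.2) := by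
    rw [real_inner_comm, inner_toEuclideanCLM, Fintype.sum_prod_type]
    simp [dotProduct, mulVec, Fin.sum_univ_three, hS]
    ring
  have hcs := Finset.sum_mul_sq_le_sq_mul_sq Finset.univ (fun q : Fin 3 × Fin 3 => S q.1 q.2)
    (fun q => a q.1 * a q.2)
  have h2 : ∑ q : Fin 3 × Fin 3, S q.1 q.2 ^ 2 = frob S S := by
    rw [Fintype.sum_prod_type]; simp [frob, sq]
  have h3 : ∑ q : Fin 3 × Fin 3, (a q.1 * a q.2) ^ 2 = (‖a‖ ^ 2) ^ 2 := by
    rw [Fintype.sum_prod_type, EuclideanSpace.norm_sq_eq]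
    simp [Fin.sum_univ_three]; ring
  rw [h2, h3] at hcs
  rw [h1, abs_mul, strainNorm, mul_assoc, abs_of_pos (by norm_num : (0 : ℝ) < 1 / 2)]
  gcongr
  refine abs_le_of_sq_le_sq ?_ (by positivity)
  rwa [mul_pow, Real.sq_sqrt (frob_self_nonneg _)]

/-! ### The velocity in spatial coordinates -/

section Spatial

variable {K : Set E3} {f : E3 → E3}

/-- The image of `K \ N` is compact, hence closed, and by injectivity misses `f X`. -/
theorem eventually_of_injOn_compact (hK : IsCompact K) (hf : ContinuousOn f K) (hinj : InjOn f K)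
    {X : E3} (hX : X ∈ K) {N : Set E3} (hN : IsOpen N) (hXN : X ∈ N) :
    ∀ᶠ z in 𝓝 (f X), ∀ Y ∈ K, f Y = z → Y ∈ N := by
  have hc : IsClosed (f '' (K \ N)) :=
    ((hK.diff hN).image_of_continuousOn (hf.mono sdiff_subset)).isClosed
  have hX' : f X ∉ f '' (K \ N) := by
    rintro ⟨Y, hY, hYX⟩
    exact hY.2 (hinj hY.1 hX hYX ▸ hXN)
  filter_upwards [hc.isOpen_compl.mem_nhds hX'] with z hz Y hY hYz
  by_contra hYN
  exact hz ⟨Y, ⟨hY, hYN⟩, hYz⟩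

end Spatial

/-- The velocity field in spatial coordinates, extended by zero. -/
def spatialField (Ω : Set E3) (f a : E3 → E3) : E3 → E3 :=
  (f '' Ω).indicator fun z => a (Function.invFunOn f Ω z)

section SpatialField

variable {Ω : Set E3} {f a : E3 → E3}

theorem spatialField_apply (hinj : InjOn f (closure Ω)) {X : E3} (hX : X ∈ Ω) :
    spatialField Ω f a (f X) = a X := by
  rw [spatialField, indicator_of_mem (mem_image_of_mem f hX),
    (hinj.mono subset_closure).leftInvOn_invFunOn hX]

/-- The image of the compact set `{‖a‖ ≥ ε}` in `closure Ω` is closed and misses `z`, so the field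
is smaller than `ε` near `z`. This covers points inside, outside and on the boundary of the fluid
region. -/
theorem continuousAt_spatialField_of_zero (hb : Bornology.IsBounded Ω)
    (hf : ContinuousOn f (closure Ω)) (hinj : InjOn f (closure Ω))
    (ha : ContinuousOn a (closure Ω)) {z : E3}
    (hz : ∀ X ∈ closure Ω, f X = z → a X = 0) :
    spatialField Ω f a z = 0 ∧ ContinuousAt (spatialField Ω f a) z := by
  have h0 : spatialField Ω f a z = 0 := by
    by_cases h : z ∈ f '' Ω
    · obtain ⟨X, hX, rfl⟩ := h
      rw [spatialField_apply hinj hX, hz X (subset_closure hX) rfl]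
    · exact indicator_of_notMem h _
  refine ⟨h0, ?_⟩
  rw [ContinuousAt, h0, Metric.tendsto_nhds]
  intro ε hε
  have hK := hb.isCompact_closure
  have hC : IsCompact (closure Ω ∩ {X | ε ≤ ‖a X‖}) :=
    hK.of_isClosed_subset (ha.norm.preimage_isClosed_of_isClosed isClosed_closure isClosed_Ici)
      inter_subset_left
  have hcl : IsClosed (f '' (closure Ω ∩ {X | ε ≤ ‖a X‖})) :=
    (hC.image_of_continuousOn (hf.mono inter_subset_left)).isClosed
  have hz' : z ∉ f '' (closure Ω ∩ {X | ε ≤ ‖a X‖}) := by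
    rintro ⟨X, ⟨hX, hXε⟩, hXz⟩
    simp only [mem_ofPred_eq, hz X hX hXz, norm_zero] at hXε
    linarith
  filter_upwards [hcl.isOpen_compl.mem_nhds hz'] with y hy
  rw [dist_zero_right]
  by_cases h : y ∈ f '' Ω
  · obtain ⟨X, hX, rfl⟩ := h
    rw [spatialField_apply hinj hX]
    by_contra hge
    exact hy ⟨X, ⟨subset_closure hX, not_lt.1 hge⟩, rfl⟩
  · rw [spatialField, indicator_of_notMem h, norm_zero]
    exact hε

theorem isOpen_image_of_det_ne_zero (hΩ : IsOpen Ω) (hf : ∀ X ∈ Ω, ContDiffAt ℝ 1 f X)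
    (hdet : ∀ X ∈ Ω, (jac f X).det ≠ 0) : IsOpen (f '' Ω) := by
  rw [isOpen_iff_mem_nhds]
  rintro _ ⟨X, hX, rfl⟩
  have hs : HasStrictFDerivAt f (equivOfDetNeZero (jac f X) (hdet X hX) : E3 →L[ℝ] E3) X := by
    have := (hf X hX).hasStrictFDerivAt (by norm_num)
    rwa [fderiv_eq_toEuclideanCLM] at this
  rw [← hs.map_nhds_eq_of_equiv]
  exact image_mem_map (hΩ.mem_nhds hX)

theorem continuousAt_invFunOn (hb : Bornology.IsBounded Ω)
    (hf : ContinuousOn f (closure Ω)) (hinj : InjOn f (closure Ω)) (hW : IsOpen (f '' Ω)) {X : E3}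
    (hX : X ∈ Ω) : ContinuousAt (Function.invFunOn f Ω) (f X) := by
  have hl := (hinj.mono subset_closure).leftInvOn_invFunOn
  rw [ContinuousAt, hl hX]
  intro N hN
  obtain ⟨N', hN'N, hN'o, hXN'⟩ := mem_nhds_iff.1 hN
  refine mem_map.2 ?_
  filter_upwards [eventually_of_injOn_compact hb.isCompact_closure hf hinj (subset_closure hX)
    hN'o hXN', hW.mem_nhds (mem_image_of_mem f hX)] with z hz hzW
  obtain ⟨Y, hY, rfl⟩ := hzW
  rw [mem_preimage, hl hY]
  exact hN'N (hz Y (subset_closure hY) rfl)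

theorem hasFDerivAt_spatialField (hb : Bornology.IsBounded Ω)
    (hf : ContinuousOn f (closure Ω)) (hinj : InjOn f (closure Ω)) (hW : IsOpen (f '' Ω)) {X : E3}
    (hX : X ∈ Ω) (hfX : DifferentiableAt ℝ f X) (haX : DifferentiableAt ℝ a X)
    (hdet : (jac f X).det ≠ 0) :
    HasFDerivAt (spatialField Ω f a) (toEuclideanCLM (𝕜 := ℝ) (jac a X * (jac f X)⁻¹)) (f X) := by
  have hl := (hinj.mono subset_closure).leftInvOn_invFunOn
  have hWn := hW.mem_nhds (mem_image_of_mem f hX)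
  have hg : HasFDerivAt (Function.invFunOn f Ω)
      ((equivOfDetNeZero (jac f X) hdet).symm : E3 →L[ℝ] E3) (f X) := by
    refine HasFDerivAt.of_local_left_inverse (f := f)
      (continuousAt_invFunOn hb hf hinj hW hX) ?_ ?_
    · rw [hl hX]
      have := hfX.hasFDerivAt
      rwa [fderiv_eq_toEuclideanCLM] at this
    · filter_upwards [hWn] with y hy using Function.invFunOn_eq hy
  have ha : HasFDerivAt a (toEuclideanCLM (𝕜 := ℝ) (jac a X)) (Function.invFunOn f Ω (f X)) := by
    rw [hl hX, ← fderiv_eq_toEuclideanCLM]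
    exact haX.hasFDerivAt
  have hcomp := ha.comp (f X) hg
  rw [map_mul]
  refine HasFDerivAt.congr_of_eventuallyEq (f := a ∘ Function.invFunOn f Ω) hcomp ?_
  filter_upwards [hWn] with y hy
  exact indicator_of_mem hy _

end SpatialField

/-! ### Korn-Poincaré inequality in referential coordinates -/

/-- The factor in front of the velocity term of the Korn-Poincaré inequality. -/
def kornLower (r : ℝ) : ℝ≥0∞ :=
  ENNReal.ofReal (r / 4) ^ 2 * volume (Metric.ball (0 : E3) (r / 4))

/-- The factor in front of the strain term of the Korn-Poincaré inequality. -/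
def kornUpper (r R : ℝ) : ℝ≥0∞ :=
  ENNReal.ofReal (|R| + r) ^ 4 * (8 * (volume (Metric.ball (0 : E3) r)
    + volume (Metric.closedBall (0 : E3) R)))

theorem kornLower_toReal_pos {r : ℝ} (hr : 0 < r) : 0 < (kornLower r).toReal := by
  refine ENNReal.toReal_pos (mul_ne_zero ?_ ?_) (ENNReal.mul_ne_top (by simp) measure_ball_lt_top.ne)
  · exact pow_ne_zero _ (by simpa using hr)
  · exact (Metric.measure_ball_pos volume 0 (by positivity)).ne'

theorem kornUpper_ne_top (r R : ℝ) : kornUpper r R ≠ ⊤ :=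
  ENNReal.mul_ne_top (by simp) (ENNReal.mul_ne_top (by simp)
    (ENNReal.add_ne_top.2 ⟨measure_ball_lt_top.ne, measure_closedBall_lt_top.ne⟩))

theorem kornUpper_toReal_pos {r : ℝ} (hr : 0 < r) (R : ℝ) : 0 < (kornUpper r R).toReal := by
  refine ENNReal.toReal_pos (mul_ne_zero ?_ (mul_ne_zero (by simp) ?_)) (kornUpper_ne_top r R)
  · refine pow_ne_zero _ ?_
    simp only [ne_eq, ENNReal.ofReal_eq_zero, not_le]
    positivity
  · simp only [ne_eq, add_eq_zero, not_and_or]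
    exact Or.inl (Metric.measure_ball_pos volume 0 hr).ne'

section Referential

variable {O : Set (ℝ × E3)} {Ω A : Set E3} {χ v : ℝ → E3 → E3} {t r R : ℝ} {x₀ : E3}

/-- The Korn-Poincaré inequality in referential coordinates. -/
theorem korn_referential (hr : 0 < r) (hΩ : IsOpen Ω) (hb : Bornology.IsBounded Ω) (hO : IsOpen O)
    (hχ : ContDiffOn ℝ 2 (Function.uncurry χ) O) (hvt : ContDiffOn ℝ 2 (v t) {X | (t, X) ∈ O})
    (hsub : closure Ω ⊆ posSlice O χ t) (hinj : InjOn (χ t) (closure Ω))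
    (hA : Metric.ball x₀ r ⊆ A) (hvA : ∀ X ∈ closure Ω, χ t X ∈ A → v t X = 0)
    (hseg : ∀ y ∈ Metric.ball x₀ r, ∀ x ∈ χ t '' Ω, segment ℝ y x ⊆ χ t '' Ω ∪ A)
    (hR : χ t '' Ω ⊆ Metric.closedBall x₀ R) :
    2 * (kornLower r).toReal / (kornUpper r R).toReal * ∫ X in Ω, energyDensity χ v t X
      ≤ ∫ X in Ω, dissipation χ v t X := by
  set g := Function.invFunOn (χ t) Ω with hg
  have hl : LeftInvOn g (χ t) Ω := (hinj.mono subset_closure).leftInvOn_invFunOn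
  have hsO : closure Ω ⊆ {X | (t, X) ∈ O} := hsub.trans inter_subset_left
  have hχt : ContDiffOn ℝ 2 (χ t) {X | (t, X) ∈ O} := contDiffOn_slice hχ t
  have hOt := isOpen_slice hO t
  have hχc : ContinuousOn (χ t) (closure Ω) := hχt.continuousOn.mono hsO
  have hvc : ContinuousOn (v t) (closure Ω) := hvt.continuousOn.mono hsO
  have hpos : ∀ X ∈ closure Ω, 0 < (defGrad χ t X).det := fun X hX => (hsub hX).2
  have hχd : ∀ X ∈ Ω, ContDiffAt ℝ 2 (χ t) X := fun X hX =>
    hχt.contDiffAt (hOt.mem_nhds (hsO (subset_closure hX)))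
  have hvd : ∀ X ∈ Ω, ContDiffAt ℝ 2 (v t) X := fun X hX =>
    hvt.contDiffAt (hOt.mem_nhds (hsO (subset_closure hX)))
  have hW : IsOpen (χ t '' Ω) := isOpen_image_of_det_ne_zero hΩ
    (fun X hX => (hχd X hX).of_le (by norm_num)) fun X hX => (hpos X (subset_closure hX)).ne'
  have hGc : ContinuousOn (spatialGrad χ v t) (closure Ω) :=
    continuousOn_pi.2 fun i => continuousOn_pi.2 fun j =>
      ((contDiffOn_spatialGrad hO hχ hvt i j).continuousOn).mono hsub
  have hgc : ContinuousOn g (χ t '' Ω) := by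
    rintro _ ⟨X, hX, rfl⟩
    exact (continuousAt_invFunOn hb hχc hinj hW hX).continuousWithinAt
  have hgm : MapsTo g (χ t '' Ω) (closure Ω) := by
    rintro _ ⟨X, hX, rfl⟩
    rw [hl hX]
    exact subset_closure hX
  have hGgc : ContinuousOn (fun z => spatialGrad χ v t (g z)) (χ t '' Ω) := hGc.comp hgc hgm
  set d : E3 → ℝ := (χ t '' Ω).indicator fun z => strainNorm (spatialGrad χ v t (g z)) with hd
  have hdm : Measurable d := by
    classical
    rw [hd, ← Set.piecewise_eq_indicator]
    exact (continuous_strainNorm.comp_continuousOn hGgc).measurable_piecewise continuousOn_const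
      hW.measurableSet
  obtain ⟨b, hbd⟩ := hb.isCompact_closure.exists_bound_of_continuousOn
    (continuous_strainNorm.comp_continuousOn hGc)
  have hdb : ∀ z, d z ≤ max b 0 := by
    intro z
    by_cases hz : z ∈ χ t '' Ω
    · rw [hd, indicator_of_mem hz]
      exact ((le_abs_self _).trans (hbd _ (hgm hz))).trans (le_max_left _ _)
    · rw [hd, indicator_of_notMem hz]
      exact le_max_right _ _
  have hLc : ContinuousOn (fun z => (toEuclideanCLM (𝕜 := ℝ) (spatialGrad χ v t (g z)) :
      E3 →L[ℝ] E3)) (χ t '' Ω) := by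
    have hlin : Continuous fun M : Matrix (Fin 3) (Fin 3) ℝ =>
        (toEuclideanCLM (𝕜 := ℝ) M : E3 →L[ℝ] E3) :=
      LinearMap.continuous_of_finiteDimensional
        ((toEuclideanCLM (n := Fin 3) (𝕜 := ℝ)).toAlgEquiv.toLinearMap)
    exact hlin.comp_continuousOn hGgc
  have hkorn := korn_poincare (u := spatialField Ω (χ t) (v t)) (d := d)
    (L := fun z => toEuclideanCLM (𝕜 := ℝ) (spatialGrad χ v t (g z))) hr hW hR ?_ hLc
    (fun z hz => indicator_of_notMem hz _) hdm hdb ?_ hA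
    -- Boundary points mapped into `A` matter here, which is why `hvA` is stated on `closure Ω`.
    (fun z hz => continuousAt_spatialField_of_zero hb hχc hinj hvc
      fun X hX hXz => hvA X hX (hXz ▸ hz)) hseg
  rotate_left
  · rintro _ ⟨X, hX, rfl⟩
    rw [hl hX]
    exact hasFDerivAt_spatialField hb hχc hinj hW hX
      ((hχd X hX).differentiableAt (by norm_num)) ((hvd X hX).differentiableAt (by norm_num))
      (hpos X (subset_closure hX)).ne'
  · intro z hz x
    rw [hd, indicator_of_mem hz]
    exact abs_inner_le_strainNorm _ x
  have hder : ∀ X ∈ Ω, HasFDerivWithinAt (χ t) (fderiv ℝ (χ t) X) Ω X := fun X hX =>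
    ((hχd X hX).differentiableAt (by norm_num)).hasFDerivAt.hasFDerivWithinAt
  have hdet : ∀ X ∈ Ω, |(fderiv ℝ (χ t) X).det| = (defGrad χ t X).det := fun X hX => by
    rw [fderiv_eq_toEuclideanCLM, det_toEuclideanCLM]
    exact abs_of_pos (hpos X (subset_closure hX))
  have hcv := lintegral_image_eq_lintegral_abs_det_fderiv_mul volume hΩ.measurableSet hder
    (hinj.mono subset_closure)
  have hDc : ContinuousOn (dissipation χ v t) (closure Ω) :=
    (continuousOn_dissipation hO hχ hvt).mono hsub
  have hEc : ContinuousOn (energyDensity χ v t) (closure Ω) :=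
    ((contDiffOn_det (contDiffOn_defGrad_slice hO hχ t)).continuousOn.mono hsO).mul
      (hvc.norm.pow 2)
  have hE : ∫⁻ z in χ t '' Ω, ‖spatialField Ω (χ t) (v t) z‖ₑ ^ 2
      = ENNReal.ofReal (∫ X in Ω, energyDensity χ v t X) := by
    rw [ofReal_integral_eq_lintegral_ofReal (integrableOn_of_continuousOn_closure hb hEc), hcv]
    · refine setLIntegral_congr_fun hΩ.measurableSet fun X hX => ?_
      rw [hdet X hX, spatialField_apply hinj hX, energyDensity,
        ENNReal.ofReal_mul (hpos X (subset_closure hX)).le, ENNReal.ofReal_pow (norm_nonneg _),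
        ofReal_norm]
    · filter_upwards [ae_restrict_mem hΩ.measurableSet] with X hX
      exact mul_nonneg (hpos X (subset_closure hX)).le (by positivity)
  -- The factor `1/2` is that of `strainNorm_sq`; it becomes the `2` in the decay constant.
  have hD : ∫⁻ z, ENNReal.ofReal (d z) ^ 2
      = ENNReal.ofReal (1 / 2 * ∫ X in Ω, dissipation χ v t X) := by
    have h1 : ∫⁻ z, ENNReal.ofReal (d z) ^ 2
        = ∫⁻ z in χ t '' Ω, ENNReal.ofReal (strainNorm (spatialGrad χ v t (g z))) ^ 2 := by
      rw [← lintegral_indicator hW.measurableSet]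
      refine lintegral_congr fun z => ?_
      by_cases hz : z ∈ χ t '' Ω
      · rw [hd, indicator_of_mem hz, indicator_of_mem hz]
      · rw [hd, indicator_of_notMem hz, indicator_of_notMem hz]; simp
    rw [h1, ← integral_const_mul, ofReal_integral_eq_lintegral_ofReal
      ((integrableOn_of_continuousOn_closure hb hDc).const_mul _), hcv]
    · refine setLIntegral_congr_fun hΩ.measurableSet fun X hX => ?_
      rw [hdet X hX, hl hX, ← ENNReal.ofReal_pow (strainNorm_nonneg _), strainNorm_sq,
        ← ENNReal.ofReal_mul (hpos X (subset_closure hX)).le, dissipation]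
      congr 1
      ring
    · filter_upwards [ae_restrict_mem hΩ.measurableSet] with X hX
      have h2 := mul_nonneg (hpos X (subset_closure hX)).le
        (sq_nonneg (strainNorm (spatialGrad χ v t X)))
      rw [strainNorm_sq] at h2
      simp only [Pi.zero_apply, dissipation]
      linarith
  rw [hE, hD] at hkorn
  change kornLower r * _ ≤ kornUpper r R * _ at hkorn
  have hE0 : 0 ≤ ∫ X in Ω, energyDensity χ v t X := setIntegral_nonneg hΩ.measurableSet
    fun X hX => mul_nonneg (hpos X (subset_closure hX)).le (by positivity)
  have hD0 : 0 ≤ ∫ X in Ω, dissipation χ v t X := by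
    refine setIntegral_nonneg hΩ.measurableSet fun X hX => ?_
    have h2 := mul_nonneg (hpos X (subset_closure hX)).le
      (sq_nonneg (strainNorm (spatialGrad χ v t X)))
    rw [strainNorm_sq] at h2
    rw [dissipation]
    linarith
  have hreal := ENNReal.toReal_mono (ENNReal.mul_ne_top (kornUpper_ne_top r R) ENNReal.ofReal_ne_top) hkorn
  rw [ENNReal.toReal_mul, ENNReal.toReal_mul, ENNReal.toReal_ofReal hE0,
    ENNReal.toReal_ofReal (by positivity)] at hreal
  rw [div_mul_eq_mul_div, div_le_iff₀ (kornUpper_toReal_pos hr R)]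
  linarith

end Referential

/-! ### Grönwall's argument and conclusion -/

theorem le_mul_exp_of_deriv_le {E E' : ℝ → ℝ} {t₀ T k : ℝ}
    (hE : ∀ t ∈ Icc t₀ T, HasDerivAt E (E' t) t) (hle : ∀ t ∈ Icc t₀ T, E' t ≤ -k * E t) {t : ℝ}
    (ht : t ∈ Icc t₀ T) : E t ≤ E t₀ * Real.exp (-k * (t - t₀)) := by
  -- The integrating factor makes `h` nonincreasing, whatever the sign of `k`.
  set h : ℝ → ℝ := fun s => E s * Real.exp (k * (s - t₀)) with hh
  have hexp : ∀ s, HasDerivAt (fun s => Real.exp (k * (s - t₀))) (Real.exp (k * (s - t₀)) * k) s :=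
    fun s => by simpa using (((hasDerivAt_id s).sub_const t₀).const_mul k).exp
  have hd : ∀ s ∈ Icc t₀ T, HasDerivAt h
      (E' s * Real.exp (k * (s - t₀)) + E s * (Real.exp (k * (s - t₀)) * k)) s := fun s hs =>
    (hE s hs).mul (hexp s)
  have hanti : AntitoneOn h (Icc t₀ T) := by
    refine antitoneOn_of_deriv_nonpos (convex_Icc t₀ T)
      (fun s hs => (hd s hs).continuousAt.continuousWithinAt)
      (fun s hs => (hd s (interior_subset hs)).differentiableAt.differentiableWithinAt)
      fun s hs => ?_
    rw [(hd s (interior_subset hs)).deriv]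
    have := mul_le_mul_of_nonneg_right (hle s (interior_subset hs)) (Real.exp_pos (k * (s - t₀))).le
    linarith
  have h1 := hanti (left_mem_Icc.2 (ht.1.trans ht.2)) ht ht.1
  simp only [hh, sub_self, mul_zero, Real.exp_zero, mul_one] at h1
  rw [neg_mul, Real.exp_neg, ← div_eq_mul_inv, le_div_iff₀ (Real.exp_pos _)]
  exact h1

theorem kineticEnergy_eq {Ω : Set E3} {χ v : ℝ → E3 → E3} {t : ℝ} (ρ : ℝ) (hΩ : MeasurableSet Ω)
    (hpos : ∀ X ∈ Ω, 0 ≤ (defGrad χ t X).det) :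
    kineticEnergy ρ Ω χ v t = 1 / 2 * ρ * ∫ X in Ω, energyDensity χ v t X := by
  rw [kineticEnergy]
  congr 1
  refine setIntegral_congr_fun hΩ fun X hX => ?_
  rw [norm_smul, mul_pow, Real.norm_eq_abs, sq_abs, Real.sq_sqrt (hpos X hX), energyDensity]

end RefFlow

end

theorem theorem60 (r R : ℝ) (hr : 0 < r) :
    ∃ C : ℝ, 0 < C ∧
      ∀ (ρ μ : ℝ), 0 < ρ → 0 < μ →
      ∀ (t₀ T : ℝ) (Ω Γfree Γwall Γfix A : Set RefFlow.E3) (x₀ : RefFlow.E3)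
        (χ v : ℝ → RefFlow.E3 → RefFlow.E3) (p : ℝ → RefFlow.E3 → ℝ),
      IsOpen Ω → Bornology.IsBounded Ω →
      -- the equations of the fluid hold, with body force zero
      RefFlow.IsSolution ρ μ (fun _ _ => 0) t₀ T Ω χ v p →
      -- the boundary is made up of free, fixed impermeable and fixed no-slip parts
      frontier Ω = Γfree ∪ Γwall ∪ Γfix →
      (∀ t ∈ Set.Icc t₀ T, ∀ X ∈ Γfree, RefFlow.IsLagrangianFree μ Ω χ v p t X) →
      (∀ t ∈ Set.Icc t₀ T, ∀ X ∈ Γwall, RefFlow.IsFixedImpermeable μ Ω χ v p t X) →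
      (∀ t ∈ Set.Icc t₀ T, ∀ X ∈ Γfix, v t X = 0) →
      -- the velocity vanishes on the neighbourhood `A` of the ball of radius `r` about `x₀`
      Metric.ball x₀ r ⊆ A →
      (∀ t ∈ Set.Icc t₀ T, ∀ X ∈ closure Ω, χ t X ∈ A → v t X = 0) →
      -- the fluid region with `A` is star-shaped about the points of that ball, of radius `≤ R`
      (∀ t ∈ Set.Icc t₀ T, ∀ y ∈ Metric.ball x₀ r, ∀ x ∈ χ t '' Ω,
        segment ℝ y x ⊆ χ t '' Ω ∪ A) →
      (∀ t ∈ Set.Icc t₀ T, χ t '' Ω ⊆ Metric.closedBall x₀ R) →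
      ∀ t ∈ Set.Icc t₀ T,
        RefFlow.kineticEnergy ρ Ω χ v t
          ≤ RefFlow.kineticEnergy ρ Ω χ v t₀ * Real.exp (-2 * (μ / ρ) * C * (t - t₀)) := by
  have hlow := RefFlow.kornLower_toReal_pos hr
  have hup := RefFlow.kornUpper_toReal_pos hr R
  refine ⟨2 * (RefFlow.kornLower r).toReal / (RefFlow.kornUpper r R).toReal, by positivity, ?_⟩
  intro ρ μ hρ hμ t₀ T Ω Γfree Γwall Γfix A x₀ χ v p hΩ hb hsol hΓ hfree hwall hfix hA hvA hseg hR t ht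
  set C := 2 * (RefFlow.kornLower r).toReal / (RefFlow.kornUpper r R).toReal
  obtain ⟨O, hO, hsub, hχ, hv, hvt, hp⟩ := hsol.regular
  have hpos : ∀ s ∈ Set.Icc t₀ T, ∀ X ∈ Ω, 0 ≤ (RefFlow.defGrad χ s X).det := fun s hs X hX =>
    (hsol.det_pos s hs X (subset_closure hX)).le
  have hslice : ∀ s ∈ Set.Icc t₀ T, closure Ω ⊆ RefFlow.posSlice O χ s := fun s hs X hX =>
    ⟨hsub ⟨hs, hX⟩, hsol.det_pos s hs X hX⟩
  rw [RefFlow.kineticEnergy_eq ρ hΩ.measurableSet (hpos t ht), RefFlow.kineticEnergy_eq ρ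
    hΩ.measurableSet (hpos t₀ (Set.left_mem_Icc.2 (ht.1.trans ht.2))), mul_assoc (1 / 2 * ρ)]
  refine mul_le_mul_of_nonneg_left ?_ (by positivity)
  have hmain := RefFlow.le_mul_exp_of_deriv_le (k := 2 * (μ / ρ) * C)
    (fun s hs => RefFlow.hasDerivAt_energy hρ.ne' hΩ hb hO hχ hv (hvt s hs) (hp s hs)
      (hslice s hs) (hsol.momentum s hs) (hsol.incompressible s hs) fun X hX =>
        RefFlow.energyFlux_boundary hΩ (fun Y hY => (hsol.det_pos s hs Y hY).ne') hΓ
          (hfree s hs) (hwall s hs) (hfix s hs) hX)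
    (fun s hs => ?_) ht
  · simpa only [neg_mul] using hmain
  -- The inequality `C E ≤ D` between the energy and dissipation integrals, multiplied by `2 ν`, is
  -- the differential inequality `E' = -2 ν D ≤ -2 ν C E`.
  · have hk := RefFlow.korn_referential hr hΩ hb hO hχ (hvt s hs) (hslice s hs)
      (hsol.injective s hs) hA (hvA s hs) (hseg s hs) (hR s hs)
    have h2 : 0 ≤ 2 * (μ / ρ) := by positivity
    have := mul_le_mul_of_nonneg_left hk h2
    linarith
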